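/- Let $H_0$ be a separable infinite-dimensional complex Hilbert space, let $H,H_n\subset H_0$ ($n\in\mathbb N$) be closed subspaces with orthogonal projections $P:H_0\to H$, $P_n:H_0\to H_n$, and suppose $P_n\to P$ strongly. Let $T$ and $T_n$ be closed, densely defined linear operators in $H$ and $H_n$, respectively, with adjoints $T^*$, $T_n^*$ and resolvent sets $\rho(\cdot)$. We say that $T_n\to T$ in generalised strong resolvent sense if there are $n_0\in\mathbb N$ and $\lambda_0\in\rho(T)\cap\bigcap_{n\ge n_0}\rho(T_n)$ with $(T_n-\lambda_0)^{-1}P_nx\to(T-\lambda_0)^{-1}Px$ for all $x\in H_0$. Fix $\varepsilon>0$ and put $$\sigma_\varepsilon(T):=\{\lambda\in\mathbb C:\ \|(T-\lambda)^{-1}\|>1/\varepsilon\},$$ where $\|(T-\lambda)^{-1}\|:=\infty$ for $\lambda\in\sigma(T)$; for $\Omega\subset\mathbb C$ let $\Omega^*:=\{\overline z: z\in\Omega\}$. For $\delta>0$ define $$\sigma_{\rm ess}((T_n)_n):=\{\lambda\in\mathbb C:\ \exists\, I\subset\mathbb N\text{ infinite},\ x_n\in{\rm dom}(T_n)\ (n\in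 I),\ \|x_n\|=1,\ x_n\rightharpoonup 0\text{ in }H_0,\ \|(T_n-\lambda)x_n\|\to 0\},$$ $$\Lambda_{{\rm ess},\delta}((T_n)_n):=\{\lambda\in\mathbb C:\ \exists\, I\subset\mathbb N\text{ infinite},\ x_n\in{\rm dom}(T_n)\ (n\in I),\ \|x_n\|=1,\ x_n\rightharpoonup 0\text{ in }H_0,\ \|(T_n-\lambda)x_n\|\to \delta\},$$ $$\Lambda_{{\rm ess},(0,\varepsilon]}:=\bigcup_{\delta\in(0,\varepsilon]}\Big(\Lambda_{{\rm ess},\delta}((T_n)_n)\cap\Lambda_{{\rm ess},\delta}((T_n^*)_n)^*\Big).$$ **Theorem.** Suppose that $T_n\to T$ and $T_n^*\to T^*$ in generalised strong resolvent sense. (i) $(T_n)$ is an $\varepsilon$-pseudospectrally inclusive approximation of $T$: for every $\lambda\in\overline{\sigma_\varepsilon(T)}$ there is a sequence $(\lambda_n)_{n\in\mathbb N}$ in $\mathbb C$ with $\lambda_n\to\lambda$ such that $\lambda_n\in\overline{\sigma_\varepsilon(T_n)}$ for all sufficiently large $n$ and for every $n$ with $H_n\neq\{0\}$. (ii) Call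 $\lambda\in\mathbb C\setminus\overline{\sigma_\varepsilon(T)}$ a point of $\varepsilon$-pseudospectral pollution if there are an infinite $I\subset\mathbb N$ and $\lambda_n\in\overline{\sigma_\varepsilon(T_n)}$, $n\in I$, with $\lambda_n\to\lambda$. Every such point belongs to $$\sigma_{\rm ess}((T_n)_n)\cup\sigma_{\rm ess}((T_n^*)_n)^*\cup\Lambda_{{\rm ess},(0,\varepsilon]};\tag{1}$$ if all $T_n$ have compact resolvents, then every such point belongs to $$\big(\sigma_{\rm ess}((T_n)_n)\cap\sigma_{\rm ess}((T_n^*)_n)^*\big)\cup\Lambda_{{\rm ess},(0,\varepsilon]}.\tag{2}$$ (iii) Let $K\subset\mathbb C$ be compact with $\overline{\sigma_\varepsilon(T)}\cap K=\overline{\sigma_\varepsilon(T)\cap K}\neq\emptyset$. If the intersection of $K$ with the set (1) is contained in $\overline{\sigma_\varepsilon(T)}$, or if all $T_n$ have compact resolvents and the intersection of $K$ with the set (2) is contained in $\overline{\sigma_\varepsilon(T)}$, then $${\rm d_H}\big(\overline{\sigma_\varepsilon(T_n)}\cap K,\ \overline{\sigma_\varepsilon(T)}\cap K\big)\to 0,\qquad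 n\to\infty,$$ where ${\rm d_H}$ is the Hausdorff distance (equal to $\infty$ if exactly one of the two sets is empty). -/

import Mathlib

open Filter Topology

namespace LinearPMap

section Resolvent

variable {E : Type*} [NormedAddCommGroup E] [NormedSpace ℂ E]

/-- `R` is the bounded, everywhere defined two-sided inverse of `T - z : dom T → E`. -/
def IsResolventAt (T : E →ₗ.[ℂ] E) (z : ℂ) (R : E →L[ℂ] E) : Prop :=
  (∀ y : E, ∃ x : T.domain, (x : E) = R y ∧ T x - z • (x : E) = y) ∧
    ∀ x : T.domain, R (T x - z • (x : E)) = x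

theorem IsResolventAt.unique {T : E →ₗ.[ℂ] E} {z : ℂ} {R S : E →L[ℂ] E}
    (hR : IsResolventAt T z R) (hS : IsResolventAt T z S) : R = S := by
  ext y
  obtain ⟨x, hx, hxy⟩ := hR.1 y
  rw [← hx, ← hxy, hS.2 x]

/-- The resolvent set `ρ(T)`. -/
def resolventSet (T : E →ₗ.[ℂ] E) : Set ℂ :=
  {z | ∃ R : E →L[ℂ] E, IsResolventAt T z R}

/-- The spectrum `σ(T)`. -/
def spectrum (T : E →ₗ.[ℂ] E) : Set ℂ :=
  (resolventSet T)ᶜ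

open Classical in
/-- The resolvent `(T - z)⁻¹` for `z ∈ ρ(T)` (and `0` otherwise). -/
noncomputable def resolvent (T : E →ₗ.[ℂ] E) (z : ℂ) : E →L[ℂ] E :=
  if h : z ∈ resolventSet T then Classical.choose h else 0

theorem isResolventAt_resolvent {T : E →ₗ.[ℂ] E} {z : ℂ} (h : z ∈ resolventSet T) :
    IsResolventAt T z (resolvent T z) := by
  rw [resolvent, dif_pos h]
  exact Classical.choose_spec h

theorem IsResolventAt.resolvent_eq {T : E →ₗ.[ℂ] E} {z : ℂ} {R : E →L[ℂ] E}
    (hR : IsResolventAt T z R) : resolvent T z = R :=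
  (isResolventAt_resolvent ⟨R, hR⟩).unique hR

/-- The `ε`-pseudospectrum `σ_ε(T) = {z : ‖(T - z)⁻¹‖ > 1 / ε}`, where the norm of the resolvent
is read as `∞` on the spectrum. -/
def pseudospectrum (T : E →ₗ.[ℂ] E) (ε : ℝ) : Set ℂ :=
  {z | z ∈ spectrum T ∨ 1 / ε < ‖resolvent T z‖}

/-- `T` has compact resolvent. -/
def HasCompactResolvent (T : E →ₗ.[ℂ] E) : Prop :=
  ∃ z ∈ resolventSet T, IsCompactOperator (resolvent T z)

end Resolvent

end LinearPMap

/-- `Ω* = {conj z : z ∈ Ω}`. -/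
def conjSet (Ω : Set ℂ) : Set ℂ :=
  (starRingEnd ℂ) '' Ω

section OperatorSequences

variable {H₀ : Type*} [NormedAddCommGroup H₀] [InnerProductSpace ℂ H₀]

/-- Weak convergence to `0` in the Hilbert space `H₀`. -/
def WeaklyNull (x : ℕ → H₀) : Prop :=
  ∀ y : H₀, Tendsto (fun k => inner ℂ y (x k)) atTop (𝓝 0)

/-- Generalised strong resolvent convergence of operators `Tₙ` in `Hₙ ⊆ H₀` to an operator `T` in
`H ⊆ H₀`. -/
def GSRConverges {H : Submodule ℂ H₀} {Hn : ℕ → Submodule ℂ H₀}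
    [H.HasOrthogonalProjection] [∀ n, (Hn n).HasOrthogonalProjection]
    (Tn : ∀ n, Hn n →ₗ.[ℂ] Hn n) (T : H →ₗ.[ℂ] H) : Prop :=
  ∃ (n₀ : ℕ) (z₀ : ℂ), (∀ n ≥ n₀, z₀ ∈ (Tn n).resolventSet) ∧ z₀ ∈ T.resolventSet ∧
    ∀ x : H₀, Tendsto (fun n => (((Tn n).resolvent z₀ ((Hn n).orthogonalProjectionOnto x) : Hn n) : H₀))
      atTop (𝓝 ((T.resolvent z₀ (H.orthogonalProjectionOnto x) : H) : H₀))

/-- The limiting essential spectrum `σ_ess((Tₙ))`; the infinite index set `I ⊆ ℕ` is enumerated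
by the strictly increasing `φ`. -/
def limitingEssSpectrum {Hn : ℕ → Submodule ℂ H₀} (Tn : ∀ n, Hn n →ₗ.[ℂ] Hn n) : Set ℂ :=
  {z | ∃ φ : ℕ → ℕ, StrictMono φ ∧ ∃ x : ∀ k, (Tn (φ k)).domain,
    (∀ k, ‖((x k : Hn (φ k)) : H₀)‖ = 1) ∧ WeaklyNull (fun k => ((x k : Hn (φ k)) : H₀)) ∧
    Tendsto (fun k => ‖Tn (φ k) (x k) - z • (x k : Hn (φ k))‖) atTop (𝓝 0)}

/-- The limiting essential `δ`-near spectrum `Λ_{ess,δ}((Tₙ))`. -/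
def limitingEssNearSpectrum {Hn : ℕ → Submodule ℂ H₀} (Tn : ∀ n, Hn n →ₗ.[ℂ] Hn n)
    (δ : ℝ) : Set ℂ :=
  {z | ∃ φ : ℕ → ℕ, StrictMono φ ∧ ∃ x : ∀ k, (Tn (φ k)).domain,
    (∀ k, ‖((x k : Hn (φ k)) : H₀)‖ = 1) ∧ WeaklyNull (fun k => ((x k : Hn (φ k)) : H₀)) ∧
    Tendsto (fun k => ‖Tn (φ k) (x k) - z • (x k : Hn (φ k))‖) atTop (𝓝 δ)}

/-- `Λ_{ess,(0,ε]}`: the union over `δ ∈ (0, ε]` of `Λ_{ess,δ}((Tₙ)) ∩ Λ_{ess,δ}((Tₙ*))*`. -/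
def limitingEssNearUnion {Hn : ℕ → Submodule ℂ H₀} [∀ n, CompleteSpace (Hn n)]
    (Tn : ∀ n, Hn n →ₗ.[ℂ] Hn n) (ε : ℝ) : Set ℂ :=
  ⋃ δ ∈ Set.Ioc (0 : ℝ) ε,
    limitingEssNearSpectrum Tn δ ∩ conjSet (limitingEssNearSpectrum (fun n => (Tn n).adjoint) δ)

/-- `σ_ess((Tₙ)) ∪ σ_ess((Tₙ*))* ∪ Λ_{ess,(0,ε]}`. -/
def exceptionalSet {Hn : ℕ → Submodule ℂ H₀} [∀ n, CompleteSpace (Hn n)]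
    (Tn : ∀ n, Hn n →ₗ.[ℂ] Hn n) (ε : ℝ) : Set ℂ :=
  limitingEssSpectrum Tn ∪ conjSet (limitingEssSpectrum fun n => (Tn n).adjoint) ∪
    limitingEssNearUnion Tn ε

/-- `(σ_ess((Tₙ)) ∩ σ_ess((Tₙ*))*) ∪ Λ_{ess,(0,ε]}`. -/
def exceptionalSetCompact {Hn : ℕ → Submodule ℂ H₀} [∀ n, CompleteSpace (Hn n)]
    (Tn : ∀ n, Hn n →ₗ.[ℂ] Hn n) (ε : ℝ) : Set ℂ :=
  (limitingEssSpectrum Tn ∩ conjSet (limitingEssSpectrum fun n => (Tn n).adjoint)) ∪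
    limitingEssNearUnion Tn ε

/-- `ε`-pseudospectral inclusion: every point of the closure of `σ_ε(T)` is the limit of points
`μₙ` of the closures of `σ_ε(Tₙ)`. On the zero space every `ε`-pseudospectrum is empty, so indices
with `Hₙ = {0}` (only finitely many can occur) have to be left out. -/
def PseudospectrallyInclusive {H : Submodule ℂ H₀} {Hn : ℕ → Submodule ℂ H₀}
    (Tn : ∀ n, Hn n →ₗ.[ℂ] Hn n) (T : H →ₗ.[ℂ] H) (ε : ℝ) : Prop :=
  ∀ z ∈ closure (T.pseudospectrum ε), ∃ μ : ℕ → ℂ,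
    (∀ n, Hn n ≠ ⊥ → μ n ∈ closure ((Tn n).pseudospectrum ε)) ∧
    (∀ᶠ n in atTop, μ n ∈ closure ((Tn n).pseudospectrum ε)) ∧ Tendsto μ atTop (𝓝 z)

/-- The points of `ε`-pseudospectral pollution: limits, along some infinite set of indices, of
points of the closures of `σ_ε(Tₙ)` that do not belong to the closure of `σ_ε(T)`. -/
def pseudospectralPollution {H : Submodule ℂ H₀} {Hn : ℕ → Submodule ℂ H₀}
    (Tn : ∀ n, Hn n →ₗ.[ℂ] Hn n) (T : H →ₗ.[ℂ] H) (ε : ℝ) : Set ℂ :=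
  {z | z ∉ closure (T.pseudospectrum ε) ∧ ∃ φ : ℕ → ℕ, StrictMono φ ∧ ∃ μ : ℕ → ℂ,
    (∀ k, μ k ∈ closure ((Tn (φ k)).pseudospectrum ε)) ∧ Tendsto μ atTop (𝓝 z)}

end OperatorSequences

-- The argument is symmetric in an operator and its adjoint. By
-- `IsAdjointPair.notMem_pseudospectrum_iff`, a point `z` avoids the `ε`-pseudospectrum exactly when
-- `A - z` and `B - conj z` are both bounded below by `ε`, where `B` is the adjoint of `A`.
-- Resolvent convergence is used only through graphs: elements of the limit graphs are strong limits
-- of elements of the approximating graphs, and, by pairing with the adjoints, weak limits of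
-- bounded sequences from the approximating graphs lie in the limit graph.
--
-- Inclusion follows because a vector violating the lower bound for the limit is approximated by
-- vectors violating it for `A n`.
--
-- For pollution, take unit vectors `x` with `‖(A n - z) x‖` asymptotically at most `ε`, with weak
-- limits `x ⇀ l` and `(A n - z) x ⇀ s`. Then `(l, s)` lies in the graph of `a - z`, and subtracting
-- strong approximants of it leaves weakly null vectors whose squared norms tend to `1 - ‖l‖²` and
-- `δ² - ‖s‖²`. The lower bound `ε‖l‖ ≤ ‖s‖` keeps the quotient at most `ε²`. The degenerate case
-- `‖l‖ = 1` is excluded by the maximum principle: off the closed pseudospectrum, `‖(a - z) l‖ ≤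
-- ε‖l‖` forces `l = 0` (`eq_zero_of_norm_sub_le`).
--
-- This gives a near-eigenvalue level in `[0, ε]` for one of the two sequences. Away from both
-- limiting essential spectra the resolvents at `z` are uniformly bounded, and
-- `IsAdjointPair.exists_common_ratio` replaces that level by one shared by the operators and their
-- adjoints. With compact resolvents, lower bounds pass between an operator and its adjoint, so the
-- two limiting essential spectra agree at the relevant points. Hausdorff convergence on `K` then
-- follows by compactness.

namespace LinearPMap

-- Adjoint pairs, lower bounds and pseudospectra.

variable {E : Type*} [NormedAddCommGroup E] [InnerProductSpace ℂ E]

/-- `A` and `B` are mutually adjoint, expressed through their graphs. -/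
structure IsAdjointPair (A B : E →ₗ.[ℂ] E) : Prop where
  inner_eq : ∀ (x : A.domain) (u : B.domain), inner ℂ (u : E) (A x) = inner ℂ (B u) (x : E)
  exists_left : ∀ x y : E, (∀ u : B.domain, inner ℂ (u : E) y = inner ℂ (B u) x) →
    ∃ d : A.domain, (d : E) = x ∧ A d = y
  exists_right : ∀ x y : E, (∀ u : A.domain, inner ℂ (u : E) y = inner ℂ (A u) x) →
    ∃ d : B.domain, (d : E) = x ∧ B d = y

theorem IsAdjointPair.symm {A B : E →ₗ.[ℂ] E} (h : IsAdjointPair A B) : IsAdjointPair B A where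
  inner_eq x u := by
    rw [← inner_conj_symm, ← inner_conj_symm (A u), h.inner_eq]
  exists_left := h.exists_right
  exists_right := h.exists_left

theorem isAdjointPair_adjoint [CompleteSpace E] {A : E →ₗ.[ℂ] E} (hc : A.IsClosed)
    (hd : Dense (A.domain : Set E)) : IsAdjointPair A A.adjoint where
  inner_eq x u := ((adjoint_isFormalAdjoint hd) u x).symm
  exists_right x y h := by
    have h' : ∀ u : A.domain, inner ℂ y (u : E) = inner ℂ x (A u) := fun u => by
      rw [← inner_conj_symm, h u, inner_conj_symm]
    have hx : x ∈ A.adjoint.domain := mem_adjoint_domain_of_exists x ⟨y, h'⟩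
    exact ⟨⟨x, hx⟩, rfl, adjoint_apply_eq hd ⟨x, hx⟩ h'⟩
  exists_left x y h := by
    -- This is `A** = A` for closed `A`: in the Hilbert sum `E ⊕ E` the closed graph equals its
    -- double orthogonal complement, and its complement consists of the pairs `(-A* v, v)`.
    let L := WithLp.linearEquiv 2 ℂ (E × E)
    let g : Submodule ℂ (WithLp 2 (E × E)) := A.graph.comap (L : WithLp 2 (E × E) →ₗ[ℂ] E × E)
    have hg : _root_.IsClosed (g : Set (WithLp 2 (E × E))) := by
      have : _root_.IsClosed (A.graph : Set (E × E)) := hc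
      exact this.preimage (WithLp.prod_continuous_ofLp 2 E E)
    have hgg : gᗮᗮ = g := by
      rw [Submodule.orthogonal_orthogonal_eq_closure]
      exact hg.submodule_topologicalClosure_eq
    have key : WithLp.toLp 2 (x, y) ∈ gᗮᗮ := by
      rw [Submodule.mem_orthogonal]
      intro v hv
      rw [Submodule.mem_orthogonal] at hv
      have hv' : ∀ u : A.domain, inner ℂ (u : E) (-v.fst) = inner ℂ (A u) v.snd := fun u => by
        have := hv (WithLp.toLp 2 ((u : E), A u)) (A.mem_graph u)
        rw [WithLp.prod_inner_apply] at this
        rw [inner_neg_right]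
        exact neg_eq_of_add_eq_zero_right this
      have hd' : ∃ d : A.adjoint.domain, (d : E) = v.snd ∧ A.adjoint d = -v.fst := by
        have h' : ∀ u : A.domain, inner ℂ (-v.fst) (u : E) = inner ℂ v.snd (A u) := fun u => by
          rw [← inner_conj_symm, hv' u, inner_conj_symm]
        have hx : v.snd ∈ A.adjoint.domain := mem_adjoint_domain_of_exists _ ⟨_, h'⟩
        exact ⟨⟨_, hx⟩, rfl, adjoint_apply_eq hd ⟨_, hx⟩ h'⟩
      obtain ⟨d, hd1, hd2⟩ := hd'
      have := h d
      rw [hd1, hd2, inner_neg_left] at this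
      rw [WithLp.prod_inner_apply]
      change inner ℂ v.fst x + inner ℂ v.snd y = 0
      rw [this]; ring
    rw [hgg] at key
    have key' : (x, y) ∈ A.graph := key
    rw [mem_graph_iff] at key'
    exact key'

/-- `A - z` is bounded below by `c`. -/
def BoundedBelow (A : E →ₗ.[ℂ] E) (z : ℂ) (c : ℝ) : Prop :=
  ∀ x : A.domain, c * ‖(x : E)‖ ≤ ‖A x - z • (x : E)‖

theorem IsResolventAt.boundedBelow {A : E →ₗ.[ℂ] E} {z : ℂ} {R : E →L[ℂ] E}
    (h : IsResolventAt A z R) {c : ℝ} (hc : 0 < c) (hR : ‖R‖ ≤ 1 / c) : BoundedBelow A z c := by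
  intro x
  have h1 : ‖(x : E)‖ ≤ 1 / c * ‖A x - z • (x : E)‖ := by
    conv_lhs => rw [← h.2 x]
    exact R.le_of_opNorm_le hR _
  calc c * ‖(x : E)‖ ≤ c * (1 / c * ‖A x - z • (x : E)‖) := by gcongr
    _ = _ := by field_simp

theorem IsResolventAt.norm_le {A : E →ₗ.[ℂ] E} {z : ℂ} {R : E →L[ℂ] E}
    (h : IsResolventAt A z R) {c : ℝ} (hc : 0 < c) (hb : BoundedBelow A z c) : ‖R‖ ≤ 1 / c := by
  refine R.opNorm_le_bound (by positivity) fun y => ?_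
  obtain ⟨x, hx, hxy⟩ := h.1 y
  have := hb x
  rw [hxy, hx] at this
  rw [one_div, inv_mul_eq_div, le_div_iff₀ hc]
  linarith

theorem IsResolventAt.sub_eq {A : E →ₗ.[ℂ] E} {z w : ℂ} {R S : E →L[ℂ] E} (hR : IsResolventAt A z R)
    (hS : IsResolventAt A w S) (y : E) : R y - S y = (z - w) • R (S y) := by
  obtain ⟨x, hx, hxy⟩ := hS.1 y
  have h1 : A x - z • (x : E) = y - (z - w) • S y := by rw [← hx, ← hxy]; module
  have h2 := hR.2 x
  rw [h1, _root_.map_sub, _root_.map_smul, hx] at h2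
  rw [sub_eq_iff_eq_add] at h2
  rw [h2, add_sub_cancel_left]

variable [CompleteSpace E] {A B : E →ₗ.[ℂ] E}

theorem IsAdjointPair.isResolventAt_adjoint (h : IsAdjointPair A B) {z : ℂ} {R : E →L[ℂ] E}
    (hR : IsResolventAt A z R) : IsResolventAt B (starRingEnd ℂ z) (ContinuousLinearMap.adjoint R) := by
  constructor
  · intro y
    obtain ⟨d, hd, hd'⟩ := h.exists_right (ContinuousLinearMap.adjoint R y) (y + starRingEnd ℂ z • ContinuousLinearMap.adjoint R y)
      fun u => by
        have := ContinuousLinearMap.adjoint_inner_right R (A u - z • (u : E)) y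
        rw [hR.2 u, inner_sub_left, inner_smul_left] at this
        rw [inner_add_right, inner_smul_right, ← this]
        ring
    exact ⟨d, hd, by rw [hd, hd']; abel⟩
  · intro x
    refine ext_inner_right ℂ fun w => ?_
    obtain ⟨u, hu, huw⟩ := hR.1 w
    rw [ContinuousLinearMap.adjoint_inner_left, ← hu, inner_sub_left, inner_smul_left, ← h.inner_eq, ← huw,
      inner_sub_right, inner_smul_right]
    simp

/-- The lower bound on `A - z` gives injectivity and, with closedness of `A`, closed range; the one
on `B - conj z` makes the orthogonal complement of the range trivial. -/
theorem IsAdjointPair.exists_isResolventAt (h : IsAdjointPair A B) {z : ℂ} {c : ℝ} (hc : 0 < c)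
    (hA : BoundedBelow A z c) (hB : BoundedBelow B (starRingEnd ℂ z) c) :
    ∃ R : E →L[ℂ] E, IsResolventAt A z R := by
  let S : A.domain →ₗ[ℂ] E := A.toFun - z • A.domain.subtype
  have hS : ∀ x, S x = A x - z • (x : E) := fun x => rfl
  have hinj : Function.Injective S := by
    rw [← LinearMap.ker_eq_bot, LinearMap.ker_eq_bot']
    intro x hx
    have h1 := hA x
    rw [← hS, hx, norm_zero] at h1
    have : ‖(x : E)‖ ≤ 0 := by
      by_contra hh
      push Not at hh
      nlinarith
    exact Subtype.ext (by simpa using this)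
  have hclosed : _root_.IsClosed (LinearMap.range S : Set E) := by
    refine isClosed_of_closure_subset fun y hy => ?_
    obtain ⟨v, hv, hvy⟩ := mem_closure_iff_seq_limit.1 hy
    choose x hx using hv
    have hcau : CauchySeq fun n => (x n : E) := by
      have h1 : CauchySeq fun n => S (x n) := by
        simp only [hx]; exact hvy.cauchySeq
      rw [Metric.cauchySeq_iff] at h1 ⊢
      intro e he
      obtain ⟨N, hN⟩ := h1 (c * e) (by positivity)
      refine ⟨N, fun m hm n hn => ?_⟩
      have h2 := hN m hm n hn
      rw [dist_eq_norm] at h2 ⊢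
      rw [← _root_.map_sub] at h2
      have h3 := hA (x m - x n)
      rw [← hS] at h3
      have h4 : c * ‖((x m - x n : A.domain) : E)‖ < c * e := h3.trans_lt h2
      exact lt_of_mul_lt_mul_left h4 hc.le
    obtain ⟨l, hl⟩ := cauchySeq_tendsto_of_complete hcau
    -- Closedness of `A` enters here, in weak form: the limit pair satisfies the adjoint identity
    -- against all of `dom B`.
    obtain ⟨d, hd, hd'⟩ := h.exists_left l (y + z • l) fun u => by
      have h1 : Tendsto (fun n => inner ℂ (u : E) (A (x n))) atTop
          (𝓝 (inner ℂ (u : E) (y + z • l))) := by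
        refine tendsto_const_nhds.inner ?_
        have : (fun n => A (x n)) = fun n => v n + z • (x n : E) := by
          ext n; rw [← hx, hS]; abel
        rw [this]
        exact hvy.add (hl.const_smul z)
      have h2 : Tendsto (fun n => inner ℂ (u : E) (A (x n))) atTop (𝓝 (inner ℂ (B u) l)) := by
        simp only [h.inner_eq]
        exact tendsto_const_nhds.inner hl
      exact tendsto_nhds_unique h1 h2
    exact ⟨d, by rw [hS, hd, hd']; abel⟩
  have hperp : (LinearMap.range S)ᗮ = ⊥ := by
    rw [Submodule.eq_bot_iff]
    intro w hw
    rw [Submodule.mem_orthogonal] at hw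
    obtain ⟨d, hd, hd'⟩ := h.exists_right w (starRingEnd ℂ z • w) fun u => by
      have := hw (S u) ⟨u, rfl⟩
      rw [hS, inner_sub_left, inner_smul_left] at this
      rw [inner_smul_right]
      linear_combination -this
    have h1 := hB d
    rw [hd', hd, sub_self, norm_zero] at h1
    have : ‖w‖ ≤ 0 := by
      by_contra hh
      push Not at hh
      nlinarith
    simpa using this
  have htop : LinearMap.range S = ⊤ := by
    rw [← hclosed.submodule_topologicalClosure_eq,
      ← Submodule.orthogonal_orthogonal_eq_closure, hperp, Submodule.bot_orthogonal_eq_top]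
  let e := LinearEquiv.ofBijective S ⟨hinj, LinearMap.range_eq_top.1 htop⟩
  have he : ∀ y, S (e.symm y) = y := fun y => e.apply_symm_apply y
  let R : E →L[ℂ] E := (A.domain.subtype ∘ₗ (e.symm : E →ₗ[ℂ] A.domain)).mkContinuous (1 / c)
    fun y => by
      have := hA (e.symm y)
      rw [← hS, he] at this
      rw [one_div, inv_mul_eq_div, le_div_iff₀ hc]
      change ‖((e.symm y : A.domain) : E)‖ * c ≤ ‖y‖
      linarith
  refine ⟨R, fun y => ⟨e.symm y, rfl, he y⟩, fun x => ?_⟩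
  change ((e.symm (S x) : A.domain) : E) = x
  exact congrArg Subtype.val (e.symm_apply_apply x)

theorem IsAdjointPair.notMem_pseudospectrum_iff (h : IsAdjointPair A B) {z : ℂ} {ε : ℝ}
    (hε : 0 < ε) : z ∉ A.pseudospectrum ε ↔
      BoundedBelow A z ε ∧ BoundedBelow B (starRingEnd ℂ z) ε := by
  constructor
  · intro hz
    simp only [pseudospectrum, spectrum, Set.mem_ofPred_eq, not_or, Set.mem_compl_iff, not_not,
      not_lt] at hz
    have hR := isResolventAt_resolvent hz.1
    refine ⟨hR.boundedBelow hε hz.2, (h.isResolventAt_adjoint hR).boundedBelow hε ?_⟩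
    exact (LinearIsometryEquiv.norm_map ContinuousLinearMap.adjoint _).trans_le hz.2
  · rintro ⟨hA, hB⟩
    obtain ⟨R, hR⟩ := h.exists_isResolventAt hε hA hB
    simp only [pseudospectrum, spectrum, Set.mem_ofPred_eq, not_or, Set.mem_compl_iff, not_not,
      not_lt]
    exact ⟨⟨R, hR⟩, hR.resolvent_eq ▸ hR.norm_le hε hA⟩

theorem IsAdjointPair.conj_notMem_pseudospectrum (h : IsAdjointPair A B) {z : ℂ} {ε : ℝ}
    (hε : 0 < ε) (hz : z ∉ A.pseudospectrum ε) : starRingEnd ℂ z ∉ B.pseudospectrum ε := by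
  rw [h.symm.notMem_pseudospectrum_iff hε, Complex.conj_conj]
  exact ((h.notMem_pseudospectrum_iff hε).1 hz).symm

theorem IsAdjointPair.conj_notMem_closure_pseudospectrum (h : IsAdjointPair A B) {z : ℂ} {ε : ℝ}
    (hε : 0 < ε) (hz : z ∉ _root_.closure (A.pseudospectrum ε)) :
    starRingEnd ℂ z ∉ _root_.closure (B.pseudospectrum ε) := by
  intro hz'
  refine hz (map_mem_closure Complex.continuous_conj hz' ?_ |> fun h => by
    rwa [Complex.conj_conj] at h)
  intro w hw
  by_contra hw'
  have := h.conj_notMem_pseudospectrum hε hw'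
  rw [Complex.conj_conj] at this
  exact this hw

end LinearPMap

-- Analyticity of the resolvent, compact resolvents, and a common ratio for an operator and its
-- adjoint.

namespace LinearPMap

section

variable {E : Type*} [NormedAddCommGroup E] [InnerProductSpace ℂ E] {A : E →ₗ.[ℂ] E}

theorem IsResolventAt.eq_zero {z : ℂ} {R : E →L[ℂ] E} (hR : IsResolventAt A z R) {y : E}
    (hy : R y = 0) : y = 0 := by
  obtain ⟨x, hx, hxy⟩ := hR.1 y
  have hx0 : x = 0 := Subtype.ext (hx.trans hy)
  rw [← hxy, hx0]
  simp

/-- The resolvent identity with a local norm bound gives strong continuity, and then identifies the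
difference quotient with `R w (R z y)`. -/
theorem hasDerivAt_resolvent_apply {R : ℂ → E →L[ℂ] E} {z : ℂ} {M : ℝ}
    (hR : ∀ᶠ w in 𝓝 z, IsResolventAt A w (R w) ∧ ‖R w‖ ≤ M) (y : E) :
    HasDerivAt (fun w => R w y) (R z (R z y)) z := by
  have hz := hR.self_of_nhds.1
  have hcont : ∀ v : E, Tendsto (fun w => R w v) (𝓝 z) (𝓝 (R z v)) := fun v => by
    rw [tendsto_iff_norm_sub_tendsto_zero]
    have h1 : Tendsto (fun w : ℂ => ‖w - z‖ * (M * ‖R z v‖)) (𝓝 z) (𝓝 0) := by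
      have : Tendsto (fun w : ℂ => ‖w - z‖ * (M * ‖R z v‖)) (𝓝 z)
          (𝓝 (‖z - z‖ * (M * ‖R z v‖))) := by
        apply Continuous.tendsto
        fun_prop
      simpa using this
    refine squeeze_zero' (Eventually.of_forall fun _ => norm_nonneg _) ?_ h1
    filter_upwards [hR] with w hw
    rw [hw.1.sub_eq hz, norm_smul]
    gcongr
    exact (R w).le_of_opNorm_le hw.2 _
  rw [hasDerivAt_iff_tendsto_slope]
  refine ((hcont (R z y)).mono_left nhdsWithin_le_nhds).congr' ?_
  filter_upwards [self_mem_nhdsWithin, hR.filter_mono nhdsWithin_le_nhds] with w hw hw'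
  have hne : w - z ≠ 0 := sub_ne_zero.2 hw
  rw [slope_def_module, hw'.1.sub_eq hz, smul_smul, inv_mul_cancel₀ hne, one_smul]

end

variable {E : Type*} [NormedAddCommGroup E] [InnerProductSpace ℂ E] {A B : E →ₗ.[ℂ] E}

theorem isResolventAt_of_notMem_pseudospectrum {z : ℂ} {ε : ℝ} (hz : z ∉ A.pseudospectrum ε) :
    IsResolventAt A z (resolvent A z) ∧ ‖resolvent A z‖ ≤ 1 / ε := by
  simp only [pseudospectrum, spectrum, Set.mem_ofPred_eq, not_or, Set.mem_compl_iff, not_not,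
    not_lt] at hz
  exact ⟨isResolventAt_resolvent hz.1, hz.2⟩

/-- Put `y = (A - z) x`. Near `z` the analytic function `w ↦ (A - w)⁻¹ y` has norm at most `‖x‖`,
attained at `z`. In a strictly convex space the maximum principle makes it constant, so `(A - w) x =
y` for some `w ≠ z` as well, whence `x = 0`. -/
theorem eq_zero_of_norm_sub_le [CompleteSpace E] {z : ℂ} {ε : ℝ} (hε : 0 < ε)
    (hz : z ∉ _root_.closure (A.pseudospectrum ε)) (x : A.domain)
    (hx : ‖A x - z • (x : E)‖ ≤ ε * ‖(x : E)‖) : (x : E) = 0 := by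
  have hev : ∀ᶠ w in 𝓝 z, w ∉ A.pseudospectrum ε :=
    (isClosed_closure.isOpen_compl.eventually_mem hz).mono fun w hw hw' => hw (subset_closure hw')
  have hev' : ∀ᶠ w in 𝓝 z, IsResolventAt A w (resolvent A w) ∧ ‖resolvent A w‖ ≤ 1 / ε :=
    hev.mono fun w hw => isResolventAt_of_notMem_pseudospectrum hw
  set y := A x - z • (x : E) with hy
  have hfz : resolvent A z y = x := hev'.self_of_nhds.1.2 x
  have : StrictConvexSpace ℝ E := by
    let _ := InnerProductSpace.complexToReal (G := E)
    infer_instance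
  have hconst := Complex.eventually_eq_of_isLocalMax_norm (f := fun w => resolvent A w y) (c := z)
    (hev'.eventually_nhds.mono fun w hw => (hasDerivAt_resolvent_apply hw y).differentiableAt)
    (hev'.mono fun w hw => by
      simp only [Function.comp_apply, hfz]
      calc ‖resolvent A w y‖ ≤ 1 / ε * ‖y‖ := (resolvent A w).le_of_opNorm_le hw.2 _
        _ ≤ 1 / ε * (ε * ‖(x : E)‖) := by gcongr
        _ = ‖(x : E)‖ := by field_simp)
  obtain ⟨w, hw, hwe, hwr⟩ := ((eventually_mem_nhdsWithin (a := z) (s := {z}ᶜ)).and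
    ((hconst.and hev').filter_mono nhdsWithin_le_nhds)).exists
  obtain ⟨x', hx', hxy'⟩ := hwr.1.1 y
  have hxx : x' = x := Subtype.ext (by rw [hx', hwe, hfz])
  rw [hxx, hy] at hxy'
  have h0 : (z - w) • (x : E) = 0 := by
    rw [sub_smul, sub_eq_zero]
    exact (sub_right_injective hxy').symm
  exact (smul_eq_zero.1 h0).resolve_left (sub_ne_zero.2 (Ne.symm hw))

/-- Liouville: otherwise the resolvent would be a bounded entire function, hence constant, and the
resolvent identity would force the space to be trivial. -/
theorem pseudospectrum_nonempty [CompleteSpace E] [Nontrivial E] (A : E →ₗ.[ℂ] E) (ε : ℝ) :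
    (A.pseudospectrum ε).Nonempty := by
  by_contra hne
  rw [Set.not_nonempty_iff_eq_empty] at hne
  have hR : ∀ w, IsResolventAt A w (resolvent A w) ∧ ‖resolvent A w‖ ≤ 1 / ε := fun w =>
    isResolventAt_of_notMem_pseudospectrum (by simp [hne])
  have hzero : ∀ y : E, y = 0 := fun y => by
    have hd : Differentiable ℂ fun w => resolvent A w y := fun w =>
      (hasDerivAt_resolvent_apply (Eventually.of_forall hR) y).differentiableAt
    have hb : Bornology.IsBounded (Set.range fun w => resolvent A w y) := by
      rw [isBounded_iff_forall_norm_le]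
      refine ⟨1 / ε * ‖y‖, ?_⟩
      rintro _ ⟨w, rfl⟩
      exact (resolvent A w).le_of_opNorm_le (hR w).2 _
    have h1 : resolvent A 0 y = resolvent A 1 y := hd.apply_eq_apply_of_bounded hb 0 1
    have h2 := (hR 0).1.sub_eq (hR 1).1 y
    rw [h1, sub_self, zero_sub, neg_one_smul, eq_comm, neg_eq_zero] at h2
    exact (hR 1).1.eq_zero ((hR 0).1.eq_zero h2)
  obtain ⟨y, hy⟩ := exists_ne (0 : E)
  exact hy (hzero y)

/-- Fredholm alternative for `R = (A - w)⁻¹`, via the factorisation `A - z = (z - w) ((z - w)⁻¹ - R)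
(A - w)`: an eigenvalue `(z - w)⁻¹` of `R` would put `z` among the eigenvalues of `A`. -/
theorem HasCompactResolvent.mem_resolventSet [CompleteSpace E] (hA : A.HasCompactResolvent) {z : ℂ}
    {c : ℝ} (hc : 0 < c) (hb : BoundedBelow A z c) : z ∈ A.resolventSet := by
  obtain ⟨w, hw, hcomp⟩ := hA
  have hR := isResolventAt_resolvent hw
  set R := resolvent A w
  by_cases hzw : z = w
  · rwa [hzw]
  have hne : z - w ≠ 0 := sub_ne_zero.2 hzw
  rcases hcomp.hasEigenvalue_or_mem_resolventSet (inv_ne_zero hne) with h | h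
  · exfalso
    obtain ⟨v, hv⟩ := h.exists_hasEigenvector
    have hv1 : R v = (z - w)⁻¹ • v := hv.apply_eq_smul
    obtain ⟨x, hx, hxv⟩ := hR.1 v
    have hvx : v = (z - w) • (x : E) := by
      rw [hx, hv1, smul_smul, mul_inv_cancel₀ hne, one_smul]
    have h0 : A x - z • (x : E) = 0 := by
      have : A x = w • (x : E) + v := by rw [← hxv]; abel
      rw [this, hvx]; module
    have h1 := hb x
    rw [h0, norm_zero] at h1
    have hx0 : (x : E) = 0 := by
      have := norm_nonneg (x : E)
      have : ‖(x : E)‖ = 0 := by nlinarith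
      simpa using this
    exact hv.2 (by rw [hvx, hx0, smul_zero])
  · rw [_root_.spectrum.mem_resolventSet_iff] at h
    obtain ⟨U, hU⟩ := h
    have hU1 : ∀ y, (z - w)⁻¹ • (U⁻¹.val y) - R (U⁻¹.val y) = y := fun y => by
      have := congrArg (fun T : E →L[ℂ] E => T y) U.mul_inv
      simpa [hU, Algebra.algebraMap_eq_smul_one] using this
    have hU2 : ∀ y, U⁻¹.val ((z - w)⁻¹ • y - R y) = y := fun y => by
      have := congrArg (fun T : E →L[ℂ] E => T y) U.inv_mul
      simpa [hU, Algebra.algebraMap_eq_smul_one] using this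
    refine ⟨(z - w)⁻¹ • (R * U⁻¹.val), fun y => ?_, fun x => ?_⟩
    · obtain ⟨x, hx, hxy⟩ := hR.1 ((z - w)⁻¹ • U⁻¹.val y)
      refine ⟨x, by simp [hx], ?_⟩
      have h1 : A x = (z - w)⁻¹ • U⁻¹.val y + w • (x : E) := by rw [← hxy]; abel
      have h2 : (z - w) • (x : E) = R (U⁻¹.val y) := by
        rw [hx, _root_.map_smul, smul_smul, mul_inv_cancel₀ hne, one_smul]
      calc A x - z • (x : E) = (z - w)⁻¹ • U⁻¹.val y - (z - w) • (x : E) := by rw [h1]; module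
        _ = y := by rw [h2, hU1]
    · set v := A x - w • (x : E) with hv
      have hxv : (x : E) = R v := (hR.2 x).symm
      have h1 : A x - z • (x : E) = (z - w) • ((z - w)⁻¹ • v - R v) := by
        rw [smul_sub, smul_smul, mul_inv_cancel₀ hne, one_smul, ← hxv, hv]; module
      rw [h1]
      rw [_root_.smul_apply, _root_.map_smul, smul_smul, inv_mul_cancel₀ hne, one_smul, hxv]
      exact congrArg R (hU2 v)

/-- Since `‖T* x‖² ≤ ‖T T* x‖ ‖x‖`, a finite net for the image of the unit ball under the compact
operator `T T*` yields one for its image under `T*`. Differences in the ball have norm at most `2`,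
hence the mesh `e ^ 2 / 2`. -/
theorem _root_.IsCompactOperator.adjoint [CompleteSpace E] {T : E →L[ℂ] E}
    (hT : IsCompactOperator T) : IsCompactOperator (ContinuousLinearMap.adjoint T) := by
  set S := ContinuousLinearMap.adjoint T with hS
  have hTS : IsCompactOperator (T ∘ S) := hT.comp_clm S
  have hTS' : IsCompactOperator ((T ∘L S : E →L[ℂ] E) : E →ₗ[ℂ] E) := hTS
  have hK := (isCompactOperator_iff_isCompact_closure_image_ball
    ((T ∘L S : E →L[ℂ] E) : E →ₗ[ℂ] E) one_pos).1 hTS'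
  refine (isCompactOperator_iff_isCompact_closure_image_ball (S : E →ₗ[ℂ] E) one_pos).2 ?_
  refine isCompact_iff_totallyBounded_isComplete.2
    ⟨TotallyBounded.closure ?_, isClosed_closure.isComplete⟩
  have hK' := hK.totallyBounded.subset subset_closure
  rw [Metric.totallyBounded_iff]
  intro e he
  obtain ⟨t, ht, htf, hcov⟩ := Metric.finite_approx_of_totallyBounded hK' (e ^ 2 / 2) (by positivity)
  have ht' : ∀ y, y ∈ t → ∃ x ∈ Metric.ball (0 : E) 1, T (S x) = y := fun y hy => ht hy
  choose! g hg using ht'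
  refine ⟨(fun y => S (g y)) '' t, htf.image _, ?_⟩
  rintro _ ⟨x, hx, rfl⟩
  obtain ⟨y, hy, hxy⟩ := Set.mem_iUnion₂.1 (hcov ⟨x, hx, rfl⟩)
  refine Set.mem_iUnion₂.2 ⟨S (g y), ⟨y, hy, rfl⟩, ?_⟩
  obtain ⟨hg1, hg2⟩ := hg y hy
  rw [Metric.mem_ball, dist_eq_norm, ← hg2] at hxy
  rw [Metric.mem_ball, dist_eq_norm]
  rw [mem_ball_zero_iff] at hx hg1
  have h1 : ‖T (S (x - g y))‖ < e ^ 2 / 2 := by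
    simpa only [_root_.map_sub, ContinuousLinearMap.coe_coe, ContinuousLinearMap.comp_apply]
      using hxy
  have h2 : ‖S (x - g y)‖ ^ 2 ≤ ‖T (S (x - g y))‖ * ‖x - g y‖ := by
    rw [← inner_self_eq_norm_sq (𝕜 := ℂ) (S (x - g y))]
    nth_rewrite 2 [hS]
    rw [ContinuousLinearMap.adjoint_inner_right]
    exact re_inner_le_norm _ _
  have h3 : ‖x - g y‖ ≤ 2 := (norm_sub_le _ _).trans (by linarith)
  have h4 : ‖S (x - g y)‖ < e := by
    refine lt_of_pow_lt_pow_left₀ 2 he.le ?_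
    nlinarith [norm_nonneg (T (S (x - g y)))]
  simpa only [_root_.map_sub, ContinuousLinearMap.coe_coe] using h4

theorem IsAdjointPair.hasCompactResolvent [CompleteSpace E] (h : IsAdjointPair A B)
    (hA : A.HasCompactResolvent) : B.HasCompactResolvent := by
  obtain ⟨w, hw, hcomp⟩ := hA
  have hR := h.isResolventAt_adjoint (isResolventAt_resolvent hw)
  exact ⟨_, ⟨_, hR⟩, hR.resolvent_eq ▸ hcomp.adjoint⟩

theorem IsAdjointPair.boundedBelow_of_hasCompactResolvent [CompleteSpace E] (h : IsAdjointPair A B)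
    (hA : A.HasCompactResolvent) {z : ℂ} {c : ℝ} (hc : 0 < c) (hb : BoundedBelow A z c) :
    BoundedBelow B (starRingEnd ℂ z) c := by
  have hR := isResolventAt_resolvent (hA.mem_resolventSet hc hb)
  refine (h.isResolventAt_adjoint hR).boundedBelow hc ?_
  exact (LinearIsometryEquiv.norm_map ContinuousLinearMap.adjoint _).trans_le (hR.norm_le hc hb)

/-- An intermediate value argument on the segment between two almost singular vectors of the
resolvent. -/
theorem IsAdjointPair.exists_common_ratio [CompleteSpace E] (h : IsAdjointPair A B) {z : ℂ}
    {c : ℝ} (hc : 0 < c) (hA : BoundedBelow A z c) (hB : BoundedBelow B (starRingEnd ℂ z) c)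
    (x : A.domain) (hx : ‖(x : E)‖ = 1) :
    ∃ (p : A.domain) (q : B.domain) (b t : ℝ), t ∈ Set.Icc (0 : ℝ) 1 ∧
      A p - z • (p : E) = (((1 - t) * ‖A x - z • (x : E)‖⁻¹ : ℝ) : ℂ) • (A x - z • (x : E)) +
        ((t * b⁻¹ : ℝ) : ℂ) • (q : E) ∧
      B q - starRingEnd ℂ z • (q : E) = x ∧ ‖(q : E)‖ = b ∧
      ‖(p : E)‖ = b * ‖A p - z • (p : E)‖ ∧ 1 / 2 ≤ ‖A p - z • (p : E)‖ ^ 2 ∧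
      ‖A p - z • (p : E)‖ ≤ 1 ∧ 1 ≤ b * ‖A x - z • (x : E)‖ ∧ b ≤ 1 / c := by
  obtain ⟨R, hR⟩ := h.exists_isResolventAt hc hA hB
  set s := A x - z • (x : E) with hs
  have hRs : R s = x := hR.2 x
  have hspos : 0 < ‖s‖ := by
    have := hA x
    rw [hx] at this
    exact lt_of_lt_of_le (by linarith) this
  -- Here `q = R* x`, so `⟪s, q⟫ = ⟪R s, x⟫ = 1`. Its ratio `‖(B - conj z) q‖ / ‖q‖ = 1 / b` is the
  -- one to be matched by some `p`.
  obtain ⟨q, hq, hqx⟩ := (h.isResolventAt_adjoint hR).1 x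
  have hqs : inner ℂ s (q : E) = 1 := by
    rw [hq, ContinuousLinearMap.adjoint_inner_right, hRs, inner_self_eq_norm_sq_to_K, hx]
    simp
  set b := ‖(q : E)‖ with hb
  have hbs : 1 ≤ b * ‖s‖ := by
    have := norm_inner_le_norm (𝕜 := ℂ) s (q : E)
    rw [hqs, norm_one] at this
    linarith
  have hbpos : 0 < b := by
    by_contra hh
    push Not at hh
    nlinarith
  have hbc : b ≤ 1 / c := by
    have := hB q
    rw [hqx, hx] at this
    rw [le_div_iff₀ hc]
    linarith
  let r : ℝ → E := fun t => (((1 - t) * ‖s‖⁻¹ : ℝ) : ℂ) • s + ((t * b⁻¹ : ℝ) : ℂ) • (q : E)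
  have hrc : Continuous r := by fun_prop
  have hr0 : r 0 = ((‖s‖⁻¹ : ℝ) : ℂ) • s := by simp [r]
  have hr1 : r 1 = ((b⁻¹ : ℝ) : ℂ) • (q : E) := by simp [r]
  have hnorm : ∀ a : ℝ, 0 ≤ a → ∀ v : E, ‖(a : ℂ) • v‖ = a * ‖v‖ := fun a ha v => by
    rw [norm_smul, Complex.norm_real, Real.norm_of_nonneg ha]
  -- On the segment from `s / ‖s‖` to `q / b`, the quantity `‖R r‖ - b ‖r‖` is nonpositive at the
  -- start, as `‖s‖⁻¹ ≤ b`, and nonnegative at the end, as `⟪R q, x⟫ = ‖q‖² = b²`. At a zero, `p = R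
  -- r` has the required ratio.
  obtain ⟨t, ht, htz⟩ : (0 : ℝ) ∈ (fun t => ‖R (r t)‖ - b * ‖r t‖) '' Set.Icc 0 1 := by
    refine intermediate_value_Icc zero_le_one (by fun_prop) ⟨?_, ?_⟩
    · simp only [hr0, _root_.map_smul, hRs]
      rw [hnorm _ (by positivity), hnorm _ (by positivity), hx, inv_mul_cancel₀ hspos.ne']
      have : ‖s‖⁻¹ ≤ b := by
        rw [inv_le_iff_one_le_mul₀ hspos]; exact hbs
      linarith
    · simp only [hr1, _root_.map_smul]
      rw [hnorm _ (by positivity), hnorm _ (by positivity), ← hb, inv_mul_cancel₀ hbpos.ne']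
      have h1 : b ^ 2 ≤ ‖R (q : E)‖ := by
        have h2 : inner ℂ (R (q : E)) (x : E) = ((b : ℂ)) ^ 2 := by
          rw [← ContinuousLinearMap.adjoint_inner_right, ← hq, inner_self_eq_norm_sq_to_K]
          rfl
        have h3 := norm_inner_le_norm (𝕜 := ℂ) (R (q : E)) (x : E)
        rw [h2, hx, norm_pow, Complex.norm_real, Real.norm_of_nonneg hbpos.le, mul_one] at h3
        exact h3
      have : b ≤ b⁻¹ * ‖R (q : E)‖ := by
        rw [inv_mul_eq_div, le_div_iff₀ hbpos]
        linarith
      linarith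
  obtain ⟨p, hp, hpr⟩ := hR.1 (r t)
  refine ⟨p, q, b, t, ht, hpr, hqx, rfl, ?_, ?_, ?_, hbs, hbc⟩
  · rw [hpr, hp]
    linarith
  · rw [hpr]
    -- The endpoints are unit vectors with positive inner product, so the segment stays away from
    -- zero: `‖r t‖² ≥ (1 - t)² + t² ≥ 1 / 2`.
    have h1 : ‖r t‖ ^ 2 = (1 - t) ^ 2 + 2 * ((1 - t) * t * (‖s‖⁻¹ * b⁻¹)) + t ^ 2 := by
      simp only [r]
      rw [@norm_add_sq ℂ, hnorm _ (mul_nonneg (by linarith [ht.2]) (by positivity)),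
        hnorm _ (mul_nonneg ht.1 (by positivity)), inner_smul_left, inner_smul_right, hqs,
        Complex.conj_ofReal, mul_one, ← Complex.ofReal_mul, mul_assoc, inv_mul_cancel₀ hspos.ne',
        mul_assoc t, ← hb, inv_mul_cancel₀ hbpos.ne']
      simp only [RCLike.re_to_complex, Complex.ofReal_re]
      ring
    have h2 : 0 ≤ (1 - t) * t * (‖s‖⁻¹ * b⁻¹) :=
      mul_nonneg (mul_nonneg (by linarith [ht.2]) ht.1) (by positivity)
    nlinarith [sq_nonneg (1 - 2 * t)]
  · rw [hpr]
    refine (norm_add_le _ _).trans ?_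
    rw [hnorm _ (mul_nonneg (by linarith [ht.2]) (by positivity)),
        hnorm _ (mul_nonneg ht.1 (by positivity)), mul_assoc, inv_mul_cancel₀ hspos.ne',
        mul_assoc t, ← hb, inv_mul_cancel₀ hbpos.ne']
    linarith

end LinearPMap

-- Weak convergence of sequences.

section WeakConvergence

variable {H₀ : Type*} [NormedAddCommGroup H₀] [InnerProductSpace ℂ H₀]

/-- Weak convergence of a sequence in an inner product space. -/
def WeakTendsto (x : ℕ → H₀) (l : H₀) : Prop :=
  ∀ y : H₀, Tendsto (fun k => inner ℂ y (x k)) atTop (𝓝 (inner ℂ y l))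

theorem weakTendsto_zero_iff {x : ℕ → H₀} : WeakTendsto x 0 ↔ WeaklyNull x := by
  simp only [WeakTendsto, WeaklyNull, inner_zero_right]

theorem WeakTendsto.comp {x : ℕ → H₀} {l : H₀} (h : WeakTendsto x l) {φ : ℕ → ℕ}
    (hφ : Tendsto φ atTop atTop) : WeakTendsto (fun k => x (φ k)) l :=
  fun y => (h y).comp hφ

theorem Filter.Tendsto.weakTendsto {x : ℕ → H₀} {l : H₀} (h : Tendsto x atTop (𝓝 l)) :
    WeakTendsto x l :=
  fun _ => tendsto_const_nhds.inner h

theorem WeakTendsto.add {x y : ℕ → H₀} {l m : H₀} (hx : WeakTendsto x l) (hy : WeakTendsto y m) :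
    WeakTendsto (fun k => x k + y k) (l + m) := fun v => by
  simpa only [inner_add_right] using (hx v).add (hy v)

theorem WeakTendsto.sub {x y : ℕ → H₀} {l m : H₀} (hx : WeakTendsto x l) (hy : WeakTendsto y m) :
    WeakTendsto (fun k => x k - y k) (l - m) := fun v => by
  simpa only [inner_sub_right] using (hx v).sub (hy v)

theorem WeakTendsto.smul {c : ℕ → ℂ} {d : ℂ} {x : ℕ → H₀} {l : H₀} (hc : Tendsto c atTop (𝓝 d))
    (hx : WeakTendsto x l) : WeakTendsto (fun k => c k • x k) (d • l) := fun v => by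
  simpa only [inner_smul_right] using hc.mul (hx v)

theorem WeakTendsto.inner_tendsto {x u : ℕ → H₀} {l v : H₀} (hx : WeakTendsto x l) {C : ℝ}
    (hC : ∀ k, ‖x k‖ ≤ C) (hu : Tendsto u atTop (𝓝 v)) :
    Tendsto (fun k => inner ℂ (u k) (x k)) atTop (𝓝 (inner ℂ v l)) := by
  have h1 : Tendsto (fun k => inner ℂ (u k - v) (x k)) atTop (𝓝 0) := by
    refine squeeze_zero_norm (a := fun k => ‖u k - v‖ * C) (fun k => ?_) ?_
    · exact (norm_inner_le_norm _ _).trans (by gcongr; exact hC k)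
    · simpa using (tendsto_iff_norm_sub_tendsto_zero.1 hu).mul_const C
  have h2 := h1.add (hx v)
  simpa only [inner_sub_left, sub_add_cancel, zero_add] using h2

theorem tendsto_norm_sub_sq_of_tendsto {x u : ℕ → H₀} {l : H₀} (hx : WeakTendsto x l) {r : ℝ}
    (hr : Tendsto (fun k => ‖x k‖) atTop (𝓝 r)) (hu : Tendsto u atTop (𝓝 l)) :
    Tendsto (fun k => ‖x k - u k‖ ^ 2) atTop (𝓝 (r ^ 2 - ‖l‖ ^ 2)) := by
  obtain ⟨C, hC⟩ := hr.bddAbove_range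
  have h1 : ∀ k, ‖x k - u k‖ ^ 2 = ‖x k‖ ^ 2 - 2 * (inner ℂ (u k) (x k)).re + ‖u k‖ ^ 2 :=
    fun k => by
      rw [@norm_sub_sq ℂ, inner_re_symm]
      rfl
  have h2 : r ^ 2 - ‖l‖ ^ 2 = r ^ 2 - 2 * (inner ℂ l l : ℂ).re + ‖l‖ ^ 2 := by
    have : (inner ℂ l l : ℂ).re = ‖l‖ ^ 2 := inner_self_eq_norm_sq (𝕜 := ℂ) l
    rw [this]; ring
  simp only [h1]
  rw [h2]
  have h3 := (Complex.continuous_re.tendsto _).comp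
    (hx.inner_tendsto (fun k => hC ⟨k, rfl⟩) hu)
  exact ((hr.pow 2).sub (h3.const_mul 2)).add (hu.norm.pow 2)

/-- Sequential Banach–Alaoglu in the dual of a separable space, transported by the Riesz isometry; a
final conjugation corrects its antilinearity. -/
theorem exists_subseq_weakTendsto [CompleteSpace H₀] [TopologicalSpace.SeparableSpace H₀]
    {x : ℕ → H₀} {C : ℝ} (hC : ∀ k, ‖x k‖ ≤ C) :
    ∃ (l : H₀) (φ : ℕ → ℕ), StrictMono φ ∧ WeakTendsto (fun k => x (φ k)) l := by
  let f : ℕ → WeakDual ℂ H₀ := fun k =>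
    StrongDual.toWeakDual (InnerProductSpace.toDual ℂ H₀ (x k))
  have hf : ∀ k, f k ∈ WeakDual.toStrongDual ⁻¹' Metric.closedBall (0 : StrongDual ℂ H₀) C :=
    fun k => by
      rw [Set.mem_preimage, mem_closedBall_zero_iff]
      exact ((InnerProductSpace.toDual ℂ H₀).norm_map (x k)).trans_le (hC k)
  obtain ⟨g, -, φ, hφ, hg⟩ := WeakDual.isSeqCompact_closedBall ℂ H₀ 0 C hf
  refine ⟨(InnerProductSpace.toDual ℂ H₀).symm (WeakDual.toStrongDual g), φ, hφ, fun y => ?_⟩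
  have h1 : Tendsto (fun k => f (φ k) y) atTop (𝓝 (g y)) :=
    ((WeakDual.eval_continuous y).tendsto g).comp hg
  have h2 : ∀ k, f (φ k) y = inner ℂ (x (φ k)) y := fun k => rfl
  have h3 : g y = inner ℂ ((InnerProductSpace.toDual ℂ H₀).symm (WeakDual.toStrongDual g)) y := by
    rw [InnerProductSpace.toDual_symm_apply]
    rfl
  simp only [h2] at h1
  rw [h3] at h1
  have h4 := (Complex.continuous_conj.tendsto _).comp h1
  simpa only [Function.comp_def, inner_conj_symm] using h4

end WeakConvergence

-- Graph convergence and weak limits of graph elements.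

section PairConvergence

variable {H₀ : Type*} [NormedAddCommGroup H₀] [InnerProductSpace ℂ H₀]
  {H : Submodule ℂ H₀} {Hn : ℕ → Submodule ℂ H₀}

/-- Every element of the graph of `a` is a limit of elements of the graphs of the `A n`. -/
def GraphConverges (A : ∀ n, Hn n →ₗ.[ℂ] Hn n) (a : H →ₗ.[ℂ] H) : Prop :=
  ∀ x : a.domain, ∃ u : ∀ n, (A n).domain,
    Tendsto (fun n => ((u n : Hn n) : H₀)) atTop (𝓝 ((x : H) : H₀)) ∧
      Tendsto (fun n => ((A n (u n) : Hn n) : H₀)) atTop (𝓝 ((a x : H) : H₀))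

/-- Write `x = (a - z)⁻¹ y`; the approximants are `(A n - z)⁻¹ Pₙ y`, with images `Pₙ y + z (A n -
z)⁻¹ Pₙ y`. -/
theorem GSRConverges.graphConverges [H.HasOrthogonalProjection]
    [∀ n, (Hn n).HasOrthogonalProjection] {A : ∀ n, Hn n →ₗ.[ℂ] Hn n} {a : H →ₗ.[ℂ] H}
    (hP : ∀ x : H₀, Tendsto (fun n => (((Hn n).orthogonalProjectionOnto x : Hn n) : H₀)) atTop
      (𝓝 ((H.orthogonalProjectionOnto x : H) : H₀)))
    (h : GSRConverges A a) : GraphConverges A a := by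
  obtain ⟨n₀, z, hz, hza, hconv⟩ := h
  intro x
  set y : H := a x - z • (x : H) with hy
  have hRy : a.resolvent z y = x := (LinearPMap.isResolventAt_resolvent hza).2 x
  have hPy : H.orthogonalProjectionOnto (y : H₀) = y :=
    H.orthogonalProjectionOnto_mem_subspace_eq_self y
  have hex : ∀ n, ∃ d : (A n).domain, n₀ ≤ n →
      (d : Hn n) = (A n).resolvent z ((Hn n).orthogonalProjectionOnto (y : H₀)) ∧
      A n d - z • (d : Hn n) = (Hn n).orthogonalProjectionOnto (y : H₀) := fun n => by
    by_cases hn : n₀ ≤ n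
    · obtain ⟨d, hd⟩ := (LinearPMap.isResolventAt_resolvent (hz n hn)).1
        ((Hn n).orthogonalProjectionOnto (y : H₀))
      exact ⟨d, fun _ => hd⟩
    · exact ⟨0, fun h => absurd h hn⟩
  choose u hu using hex
  have h1 : Tendsto (fun n => ((u n : Hn n) : H₀)) atTop (𝓝 ((x : H) : H₀)) := by
    have := hconv (y : H₀)
    rw [hPy, hRy] at this
    refine this.congr' ?_
    filter_upwards [eventually_ge_atTop n₀] with n hn
    rw [(hu n hn).1]
  refine ⟨u, h1, ?_⟩
  have h2 := (hP (y : H₀)).add (h1.const_smul z)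
  have h3 : ((H.orthogonalProjectionOnto (y : H₀) : H) : H₀) + z • ((x : H) : H₀) =
      ((a x : H) : H₀) := by
    rw [hPy, hy]
    simp
  rw [h3] at h2
  refine h2.congr' ?_
  filter_upwards [eventually_ge_atTop n₀] with n hn
  rw [← (hu n hn).2]
  simp

/-- Normalisation of weakly null sequences. -/
theorem mem_limitingEssNearSpectrum_of_tendsto {A : ∀ n, Hn n →ₗ.[ℂ] Hn n}
    {φ : ℕ → ℕ} (hφ : StrictMono φ)
    {x : ∀ k, (A (φ k)).domain} (hx : WeakTendsto (fun k => ((x k : Hn (φ k)) : H₀)) 0)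
    {z : ℂ} {α β : ℝ} (hα : 0 < α)
    (hxα : Tendsto (fun k => ‖(x k : Hn (φ k))‖) atTop (𝓝 α))
    (hxβ : Tendsto (fun k => ‖A (φ k) (x k) - z • (x k : Hn (φ k))‖) atTop (𝓝 β)) :
    z ∈ limitingEssNearSpectrum A (β / α) := by
  -- Shifting by `N` discards the indices at which the vector may vanish and cannot be normalised.
  obtain ⟨N, hN⟩ := eventually_atTop.1 (hxα.eventually (lt_mem_nhds hα))
  have hs : Tendsto (fun k => k + N) atTop atTop := tendsto_add_atTop_nat N
  have hpos : ∀ k, 0 < ‖(x (k + N) : Hn (φ (k + N)))‖ := fun k => hN _ (by omega)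
  refine ⟨fun k => φ (k + N), fun i j hij => hφ (by omega),
    fun k => ((‖(x (k + N) : Hn (φ (k + N)))‖⁻¹ : ℝ) : ℂ) • x (k + N), fun k => ?_, ?_, ?_⟩
  · change ‖((‖(x (k + N) : Hn (φ (k + N)))‖⁻¹ : ℝ) : ℂ) • (x (k + N) : Hn (φ (k + N)))‖ = 1
    rw [norm_smul, Complex.norm_real, norm_inv, norm_norm, inv_mul_cancel₀ (hpos k).ne']
  · rw [← weakTendsto_zero_iff]
    have h1 : Tendsto (fun k => ((‖(x (k + N) : Hn (φ (k + N)))‖⁻¹ : ℝ) : ℂ)) atTop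
        (𝓝 ((α⁻¹ : ℝ) : ℂ)) :=
      (Complex.continuous_ofReal.tendsto _).comp ((hxα.comp hs).inv₀ hα.ne')
    have h2 := WeakTendsto.smul h1 (hx.comp hs)
    rw [smul_zero] at h2
    exact h2
  · have h1 := (hxβ.comp hs).div (hxα.comp hs) hα.ne'
    refine h1.congr fun k => ?_
    simp only [LinearPMap.map_smul]
    rw [Submodule.coe_smul, smul_comm z, ← smul_sub, norm_smul, Complex.norm_real, norm_inv,
      norm_norm, inv_mul_eq_div]
    rfl

/-- Pairs of mutually adjoint operators in `Hn n` whose graphs approximate the graphs of a pair of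
mutually adjoint operators in `H`, the orthogonal projections being strongly convergent. -/
structure PairConverges [H.HasOrthogonalProjection] [∀ n, (Hn n).HasOrthogonalProjection]
    (A B : ∀ n, Hn n →ₗ.[ℂ] Hn n) (a b : H →ₗ.[ℂ] H) : Prop where
  proj : ∀ x : H₀, Tendsto (fun n => (((Hn n).orthogonalProjectionOnto x : Hn n) : H₀)) atTop
      (𝓝 ((H.orthogonalProjectionOnto x : H) : H₀))
  pair : ∀ n, (A n).IsAdjointPair (B n)
  pair_lim : a.IsAdjointPair b
  graph_left : GraphConverges A a
  graph_right : GraphConverges B b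

variable [H.HasOrthogonalProjection] [∀ n, (Hn n).HasOrthogonalProjection]
  {A B : ∀ n, Hn n →ₗ.[ℂ] Hn n} {a b : H →ₗ.[ℂ] H}

theorem PairConverges.symm (h : PairConverges A B a b) : PairConverges B A b a :=
  ⟨h.proj, fun n => (h.pair n).symm, h.pair_lim.symm, h.graph_right, h.graph_left⟩

theorem mem_of_weakTendsto
    (hP : ∀ x : H₀, Tendsto (fun n => (((Hn n).orthogonalProjectionOnto x : Hn n) : H₀)) atTop
      (𝓝 ((H.orthogonalProjectionOnto x : H) : H₀)))
    {φ : ℕ → ℕ} (hφ : Tendsto φ atTop atTop) {x : ∀ k, Hn (φ k)} {l : H₀} {C : ℝ}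
    (hC : ∀ k, ‖(x k : H₀)‖ ≤ C) (hx : WeakTendsto (fun k => (x k : H₀)) l) : l ∈ H := by
  have h1 : l = ((H.orthogonalProjectionOnto l : H) : H₀) := by
    refine ext_inner_left ℂ fun v => ?_
    have h2 := hx.inner_tendsto hC ((hP v).comp hφ)
    have h3 : ∀ k, inner ℂ (((Hn (φ k)).orthogonalProjectionOnto v : Hn (φ k)) : H₀) (x k : H₀) =
        inner ℂ v (x k : H₀) := fun k => by
      rw [← Submodule.coe_inner, Submodule.inner_orthogonalProjectionOnto_eq_of_mem_right]
    simp only [Function.comp_def, h3] at h2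
    rw [tendsto_nhds_unique (hx v) h2]
    exact H.inner_starProjection_left_eq_right v l
  rw [h1]
  exact Subtype.property _

/-- Test against `u ∈ dom b`: strong approximants of `(u, b u)` turn the adjoint identity at level
`φ k` into the one for `(l, m)`, and the limit adjoint pair places `(l, m)` in the graph of `a`. -/
theorem PairConverges.exists_graph_of_weakTendsto (h : PairConverges A B a b)
    {φ : ℕ → ℕ} (hφ : Tendsto φ atTop atTop) {x : ∀ k, (A (φ k)).domain} {l m : H₀} {C D : ℝ}
    (hC : ∀ k, ‖((x k : Hn (φ k)) : H₀)‖ ≤ C) (hD : ∀ k, ‖(A (φ k) (x k) : H₀)‖ ≤ D)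
    (hx : WeakTendsto (fun k => ((x k : Hn (φ k)) : H₀)) l)
    (hAx : WeakTendsto (fun k => (A (φ k) (x k) : H₀)) m) :
    ∃ d : a.domain, ((d : H) : H₀) = l ∧ ((a d : H) : H₀) = m := by
  have hl : l ∈ H := mem_of_weakTendsto h.proj hφ hC hx
  have hm : m ∈ H := mem_of_weakTendsto h.proj hφ hD hAx
  obtain ⟨d, hd, hd'⟩ := h.pair_lim.exists_left ⟨l, hl⟩ ⟨m, hm⟩ fun u => by
    obtain ⟨v, hv, hBv⟩ := h.graph_right u
    have h1 := hAx.inner_tendsto hD (hv.comp hφ)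
    have h2 := hx.inner_tendsto hC (hBv.comp hφ)
    have h3 : ∀ k, inner ℂ ((v (φ k) : Hn (φ k)) : H₀) ((A (φ k) (x k) : Hn (φ k)) : H₀) =
        inner ℂ ((B (φ k) (v (φ k)) : Hn (φ k)) : H₀) ((x k : Hn (φ k)) : H₀) := fun k =>
      (h.pair (φ k)).inner_eq (x k) (v (φ k))
    simp only [Function.comp_def, h3] at h1 h2
    exact tendsto_nhds_unique h1 h2
  exact ⟨d, by rw [hd], by rw [hd']⟩

end PairConvergence

theorem LinearPMap.exists_norm_eq_one_of_not_boundedBelow {E : Type*} [NormedAddCommGroup E]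
    [InnerProductSpace ℂ E] {A : E →ₗ.[ℂ] E} {z : ℂ} {c : ℝ} (h : ¬ A.BoundedBelow z c) :
    ∃ x : A.domain, ‖(x : E)‖ = 1 ∧ ‖A x - z • (x : E)‖ < c := by
  simp only [BoundedBelow, not_forall, not_le] at h
  obtain ⟨x, hx⟩ := h
  have hpos : 0 < ‖(x : E)‖ := by
    rw [norm_pos_iff]
    intro h0
    have : x = 0 := Subtype.ext h0
    rw [this] at hx
    simp at hx
  refine ⟨((‖(x : E)‖⁻¹ : ℝ) : ℂ) • x, ?_, ?_⟩
  · rw [Submodule.coe_smul, norm_smul, Complex.norm_real, norm_inv, norm_norm,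
      inv_mul_cancel₀ hpos.ne']
  · rw [LinearPMap.map_smul, Submodule.coe_smul, smul_comm z, ← smul_sub, norm_smul,
      Complex.norm_real, norm_inv, norm_norm, inv_mul_eq_div, div_lt_iff₀ hpos]
    exact hx

-- Singular sequences and their weakly null parts.

section Pollution

variable {H₀ : Type*} [NormedAddCommGroup H₀] [InnerProductSpace ℂ H₀]
  {H : Submodule ℂ H₀} {Hn : ℕ → Submodule ℂ H₀}
  [H.HasOrthogonalProjection] [∀ n, (Hn n).HasOrthogonalProjection]
  {A B : ∀ n, Hn n →ₗ.[ℂ] Hn n} {a b : H →ₗ.[ℂ] H}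

theorem PairConverges.exists_sub_smul_of_weakTendsto (h : PairConverges A B a b)
    {φ : ℕ → ℕ} (hφ : Tendsto φ atTop atTop) {x : ∀ k, (A (φ k)).domain} {z : ℂ} {l s : H₀}
    {C D : ℝ} (hC : ∀ k, ‖(x k : Hn (φ k))‖ ≤ C)
    (hD : ∀ k, ‖A (φ k) (x k) - z • (x k : Hn (φ k))‖ ≤ D)
    (hx : WeakTendsto (fun k => ((x k : Hn (φ k)) : H₀)) l)
    (hs : WeakTendsto (fun k => ((A (φ k) (x k) - z • (x k : Hn (φ k)) : Hn (φ k)) : H₀)) s) :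
    ∃ d : a.domain, ((d : H) : H₀) = l ∧ ((a d - z • (d : H) : H) : H₀) = s := by
  have hA : ∀ k, ((A (φ k) (x k) : Hn (φ k)) : H₀) =
      ((A (φ k) (x k) - z • (x k : Hn (φ k)) : Hn (φ k)) : H₀) + z • ((x k : Hn (φ k)) : H₀) :=
    fun k => by simp
  obtain ⟨d, hd, hd'⟩ := h.exists_graph_of_weakTendsto hφ (m := s + z • l) (D := D + ‖z‖ * C) hC
    (fun k => by
      rw [hA]
      refine (norm_add_le _ _).trans (add_le_add (hD k) ?_)
      rw [norm_smul]
      exact mul_le_mul_of_nonneg_left (hC k) (norm_nonneg _)) hx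
    (by
      simp only [hA]
      exact hs.add (WeakTendsto.smul tendsto_const_nhds hx))
  exact ⟨d, hd, by simp [hd, hd']⟩

theorem PairConverges.weakTendsto_zero_of_boundedBelow (h : PairConverges A B a b)
    {φ : ℕ → ℕ} (hφ : Tendsto φ atTop atTop) {x : ∀ k, (A (φ k)).domain} {z : ℂ} {l : H₀}
    {c C D : ℝ} (hc : 0 < c) (ha : a.BoundedBelow z c) (hC : ∀ k, ‖(x k : Hn (φ k))‖ ≤ C)
    (hD : ∀ k, ‖A (φ k) (x k) - z • (x k : Hn (φ k))‖ ≤ D)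
    (hx : WeakTendsto (fun k => ((x k : Hn (φ k)) : H₀)) l)
    (hs : WeakTendsto (fun k => ((A (φ k) (x k) - z • (x k : Hn (φ k)) : Hn (φ k)) : H₀)) 0) :
    WeakTendsto (fun k => ((x k : Hn (φ k)) : H₀)) 0 := by
  obtain ⟨d, hd, hd'⟩ := h.exists_sub_smul_of_weakTendsto hφ hC hD hx hs
  have h1 := ha d
  have h2 : a d - z • (d : H) = 0  := Subtype.ext hd'
  rw [h2, norm_zero] at h1
  have h3 : (d : H) = 0 := by
    have := norm_nonneg (d : H)
    have : ‖(d : H)‖ = 0 := by nlinarith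
    simpa using this
  rw [h3] at hd
  rwa [← hd] at hx

variable [CompleteSpace H₀] [TopologicalSpace.SeparableSpace H₀]

/-- Otherwise there are unit vectors `x` with `(A n - z) x → 0`. Their weak limit lies in the kernel
of `a - z`, which is trivial, so they witness `z ∈ limitingEssSpectrum A`. -/
theorem PairConverges.exists_eventually_boundedBelow (h : PairConverges A B a b) {z : ℂ} {c : ℝ}
    (hc : 0 < c) (ha : a.BoundedBelow z c) (hz : z ∉ limitingEssSpectrum A) :
    ∃ c' > 0, ∀ᶠ n in atTop, (A n).BoundedBelow z c' := by
  by_contra! hcon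
  have hfreq : ∀ k : ℕ, ∃ᶠ n in atTop, ¬ (A n).BoundedBelow z (1 / ((k : ℝ) + 1)) := fun k =>
    hcon _ (by positivity)
  obtain ⟨φ, hφ, hφ'⟩ := extraction_forall_of_frequently hfreq
  choose x hx hxz using fun k => LinearPMap.exists_norm_eq_one_of_not_boundedBelow (hφ' k)
  have hlim : Tendsto (fun k => ‖A (φ k) (x k) - z • (x k : Hn (φ k))‖) atTop (𝓝 0) :=
    squeeze_zero (fun _ => norm_nonneg _) (fun k => (hxz k).le) tendsto_one_div_add_atTop_nhds_zero_nat
  obtain ⟨l, ψ, hψ, hl⟩ := exists_subseq_weakTendsto (x := fun k => ((x k : Hn (φ k)) : H₀))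
    (C := 1) (fun k => (hx k).le)
  have hlim' := hlim.comp hψ.tendsto_atTop
  have h0 := h.weakTendsto_zero_of_boundedBelow (φ := fun k => φ (ψ k))
    (hφ.comp hψ).tendsto_atTop (x := fun k => x (ψ k)) (z := z) (C := 1) (D := 1) hc ha
    (fun k => (hx _).le)
    (fun k => (hxz _).le.trans (by
      rw [div_le_one (by positivity)]
      linarith [Nat.cast_nonneg (α := ℝ) (ψ k)])) hl
    (tendsto_zero_iff_norm_tendsto_zero.2 hlim').weakTendsto
  exact hz ⟨fun k => φ (ψ k), hφ.comp hψ, fun k => x (ψ k), fun k => hx _,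
    weakTendsto_zero_iff.1 h0, hlim'⟩

theorem PairConverges.exists_mem_limitingEssNearSpectrum [CompleteSpace H]
    (h : PairConverges A B a b) {z : ℂ} {ε : ℝ} (hε : 0 < ε)
    (hz : z ∉ closure (a.pseudospectrum ε)) {φ : ℕ → ℕ} (hφ : StrictMono φ)
    {x : ∀ k, (A (φ k)).domain} (hx : ∀ k, ‖(x k : Hn (φ k))‖ = 1) {η : ℕ → ℝ}
    (hη : Tendsto η atTop (𝓝 ε)) (hle : ∀ k, ‖A (φ k) (x k) - z • (x k : Hn (φ k))‖ ≤ η k) :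
    ∃ δ ∈ Set.Icc 0 ε, z ∈ limitingEssNearSpectrum A δ := by
  obtain ⟨M, hM⟩ := hη.bddAbove_range
  have hM' : ∀ k, ‖A (φ k) (x k) - z • (x k : Hn (φ k))‖ ≤ M := fun k =>
    (hle k).trans (hM ⟨k, rfl⟩)
  obtain ⟨δ, hδ, ψ₁, hψ₁, hδlim⟩ := (isCompact_Icc (a := (0 : ℝ)) (b := M)).tendsto_subseq
    (x := fun k => ‖A (φ k) (x k) - z • (x k : Hn (φ k))‖) fun k => ⟨norm_nonneg _, hM' k⟩
  obtain ⟨l, ψ₂, hψ₂, hl⟩ := exists_subseq_weakTendsto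
    (x := fun k => ((x (ψ₁ k) : Hn (φ (ψ₁ k))) : H₀)) (C := 1) (fun k => (hx _).le)
  obtain ⟨s, ψ₃, hψ₃, hs⟩ := exists_subseq_weakTendsto
    (x := fun k => ((A (φ (ψ₁ (ψ₂ k))) (x (ψ₁ (ψ₂ k))) -
      z • (x (ψ₁ (ψ₂ k)) : Hn (φ (ψ₁ (ψ₂ k)))) : Hn (φ (ψ₁ (ψ₂ k)))) : H₀)) (C := M)
    (fun k => hM' _)
  let χ : ℕ → ℕ := fun k => ψ₁ (ψ₂ (ψ₃ k))
  have hχ : StrictMono χ := hψ₁.comp (hψ₂.comp hψ₃)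
  have hφχ : StrictMono fun k => φ (χ k) := hφ.comp hχ
  have hl' : WeakTendsto (fun k => ((x (χ k) : Hn (φ (χ k))) : H₀)) l :=
    hl.comp hψ₃.tendsto_atTop
  have hδlim' : Tendsto (fun k => ‖((A (φ (χ k)) (x (χ k)) -
      z • (x (χ k) : Hn (φ (χ k))) : Hn (φ (χ k))) : H₀)‖) atTop (𝓝 δ) :=
    hδlim.comp (hψ₂.comp hψ₃).tendsto_atTop
  have hδε : δ ≤ ε :=
    le_of_tendsto_of_tendsto' hδlim' (hη.comp hχ.tendsto_atTop) fun k => hle _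
  obtain ⟨d, hd, hd'⟩ := h.exists_sub_smul_of_weakTendsto (φ := fun k => φ (χ k))
    hφχ.tendsto_atTop (x := fun k => x (χ k)) (C := 1) (fun k => (hx _).le) (fun k => hM' _) hl' hs
  -- Strong approximants of the weak limit; `x - u` is the weakly null part.
  obtain ⟨u, hu, hAu⟩ := h.graph_left d
  have hbd : ε * ‖l‖ ≤ ‖s‖ := by
    have := ((h.pair_lim.notMem_pseudospectrum_iff hε).1 fun h' => hz (subset_closure h')).1 d
    rwa [← hd, ← hd']
  have hu' := (hd ▸ hu).comp hφχ.tendsto_atTop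
  have hsu : Tendsto (fun k => ((A (φ (χ k)) (u (φ (χ k))) -
      z • (u (φ (χ k)) : Hn (φ (χ k))) : Hn (φ (χ k))) : H₀)) atTop (𝓝 s) := by
    have h1 := (hAu.sub (hu.const_smul z)).comp hφχ.tendsto_atTop
    rw [← hd']
    exact h1
  have hα : Tendsto (fun k => ‖((x (χ k) : Hn (φ (χ k))) : H₀) -
      ((u (φ (χ k)) : Hn (φ (χ k))) : H₀)‖ ^ 2) atTop (𝓝 (1 ^ 2 - ‖l‖ ^ 2)) := by
    have h0 : Tendsto (fun k => ‖((x (χ k) : Hn (φ (χ k))) : H₀)‖) atTop (𝓝 1) :=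
      tendsto_const_nhds.congr fun k => (hx _).symm
    exact tendsto_norm_sub_sq_of_tendsto hl' h0 hu'
  have hβ := tendsto_norm_sub_sq_of_tendsto hs hδlim' hsu
  have hα0 : 0 ≤ 1 ^ 2 - ‖l‖ ^ 2 := ge_of_tendsto' hα fun k => by positivity
  have hβ0 : 0 ≤ δ ^ 2 - ‖s‖ ^ 2 := ge_of_tendsto' hβ fun k => by positivity
  -- If nothing remained, then `‖l‖ = 1` and `‖s‖ ≤ δ ≤ ε ‖l‖`, which the maximum principle
  -- excludes.
  have hαpos : 0 < 1 ^ 2 - ‖l‖ ^ 2 := by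
    refine lt_of_le_of_ne hα0 fun h0 => ?_
    have hl1 : ‖l‖ = 1 := by
      have : ‖l‖ ^ 2 = 1 := by linarith
      exact (pow_eq_one_iff_of_nonneg (norm_nonneg l) two_ne_zero).1 this
    have hsε : ‖s‖ ≤ ε * ‖l‖ := by
      rw [hl1, mul_one]
      exact (abs_le_of_sq_le_sq' (by linarith) hδ.1).2.trans hδε
    have hd0 : (d : H) = 0 := LinearPMap.eq_zero_of_norm_sub_le hε hz d (by
      rw [← hd, ← hd'] at hsε
      exact hsε)
    rw [← hd, hd0] at hl1
    simp at hl1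
  have hwx : WeakTendsto (fun k => ((x (χ k) : Hn (φ (χ k))) : H₀) -
      ((u (φ (χ k)) : Hn (φ (χ k))) : H₀)) 0 := by
    have := hl'.sub hu'.weakTendsto
    rwa [sub_self] at this
  have hmem := mem_limitingEssNearSpectrum_of_tendsto hφχ
    (x := fun k => x (χ k) - u (φ (χ k))) (z := z) hwx
    (α := √(1 ^ 2 - ‖l‖ ^ 2)) (β := √(δ ^ 2 - ‖s‖ ^ 2)) (Real.sqrt_pos.2 hαpos)
    (by
      refine ((Real.continuous_sqrt.tendsto _).comp hα).congr fun k => ?_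
      exact Real.sqrt_sq (norm_nonneg _))
    (by
      refine ((Real.continuous_sqrt.tendsto _).comp hβ).congr fun k => ?_
      refine (Real.sqrt_sq (norm_nonneg _)).trans ?_
      rw [LinearPMap.map_sub, ← Submodule.coe_sub, Submodule.coe_norm]
      congr 1
      push_cast
      rw [smul_sub]
      abel)
  refine ⟨_, ⟨by positivity, ?_⟩, hmem⟩
  -- The claim reduces to `δ² - ‖s‖² ≤ ε² (1 - ‖l‖²)`, from `δ ≤ ε` and `ε ‖l‖ ≤ ‖s‖`.
  rw [div_le_iff₀ (Real.sqrt_pos.2 hαpos)]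
  refine (Real.sqrt_le_left (by positivity)).2 ?_
  rw [mul_pow, Real.sq_sqrt hα0]
  have h1 : δ ^ 2 ≤ ε ^ 2 := pow_le_pow_left₀ hδ.1 hδε 2
  have h2 : (ε * ‖l‖) ^ 2 ≤ ‖s‖ ^ 2 := pow_le_pow_left₀ (by positivity) hbd 2
  nlinarith

theorem PairConverges.exists_near_of_frequently [CompleteSpace H] (h : PairConverges A B a b)
    {z : ℂ} {ε : ℝ} (hε : 0 < ε) (hz : z ∉ closure (a.pseudospectrum ε)) {φ : ℕ → ℕ}
    (hφ : StrictMono φ) {ν : ℕ → ℂ} (hν : Tendsto ν atTop (𝓝 z))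
    (hfreq : ∃ᶠ k in atTop, ¬ (A (φ k)).BoundedBelow (ν k) ε) :
    ∃ δ ∈ Set.Icc 0 ε, z ∈ limitingEssNearSpectrum A δ := by
  obtain ⟨ψ, hψ, hψ'⟩ := extraction_of_frequently_atTop hfreq
  choose x hx hxν using fun k => LinearPMap.exists_norm_eq_one_of_not_boundedBelow (hψ' k)
  have hη : Tendsto (fun k => ε + ‖ν (ψ k) - z‖) atTop (𝓝 ε) := by
    have := ((tendsto_iff_norm_sub_tendsto_zero.1 hν).comp hψ.tendsto_atTop).const_add ε
    rwa [add_zero] at this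
  refine h.exists_mem_limitingEssNearSpectrum hε hz (φ := fun k => φ (ψ k)) (hφ.comp hψ) hx hη
    fun k => ?_
  have h1 : A (φ (ψ k)) (x k) - z • (x k : Hn (φ (ψ k))) =
      (A (φ (ψ k)) (x k) - ν (ψ k) • (x k : Hn (φ (ψ k)))) +
        (ν (ψ k) - z) • (x k : Hn (φ (ψ k))) := by module
  rw [h1]
  refine (norm_add_le _ _).trans (add_le_add (hxν k).le ?_)
  rw [norm_smul, hx, mul_one]

end Pollution

-- Locating pollution in the exceptional sets.

section Pollution

variable {H₀ : Type*} [NormedAddCommGroup H₀] [InnerProductSpace ℂ H₀]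
  {H : Submodule ℂ H₀} {Hn : ℕ → Submodule ℂ H₀}
  [H.HasOrthogonalProjection] [∀ n, (Hn n).HasOrthogonalProjection]
  {A B : ∀ n, Hn n →ₗ.[ℂ] Hn n} {a b : H →ₗ.[ℂ] H}
  [CompleteSpace H₀] [TopologicalSpace.SeparableSpace H₀] [∀ n, CompleteSpace (Hn n)]

/-- The vectors `p` and `q` from `IsAdjointPair.exists_common_ratio` have the same ratio `1 / β` for
`A n` and `B n`. What remains is to pass to limits and check that both sequences are weakly null. -/
theorem PairConverges.exists_common_mem_limitingEssNearSpectrum (h : PairConverges A B a b) {z : ℂ}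
    {c : ℝ} (hc : 0 < c) (ha : a.BoundedBelow z c) (hb : b.BoundedBelow (starRingEnd ℂ z) c)
    (hzA : z ∉ limitingEssSpectrum A) (hzB : starRingEnd ℂ z ∉ limitingEssSpectrum B) {ε δ : ℝ}
    (hδ : δ ∈ Set.Ioc 0 ε) (hz : z ∈ limitingEssNearSpectrum A δ) :
    ∃ δ' ∈ Set.Ioc 0 ε, z ∈ limitingEssNearSpectrum A δ' ∧
      starRingEnd ℂ z ∈ limitingEssNearSpectrum B δ' := by
  obtain ⟨cA, hcA, hevA⟩ := h.exists_eventually_boundedBelow hc ha hzA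
  obtain ⟨cB, hcB, hevB⟩ := h.symm.exists_eventually_boundedBelow hc hb hzB
  set m := min cA cB with hm
  have hmpos : 0 < m := lt_min hcA hcB
  have hev : ∀ᶠ n in atTop, (A n).BoundedBelow z m ∧ (B n).BoundedBelow (starRingEnd ℂ z) m := by
    filter_upwards [hevA, hevB] with n h1 h2
    exact ⟨fun x => (mul_le_mul_of_nonneg_right (min_le_left _ _) (norm_nonneg _)).trans (h1 x),
      fun x => (mul_le_mul_of_nonneg_right (min_le_right _ _) (norm_nonneg _)).trans (h2 x)⟩
  obtain ⟨N, hN⟩ := eventually_atTop.1 hev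
  obtain ⟨φ₀, hφ₀, x₀, hx₀, hx₀w, hx₀δ⟩ := hz
  let φ : ℕ → ℕ := fun k => φ₀ (k + N)
  have hφ : StrictMono φ := fun i j hij => hφ₀ (by omega)
  have hφN : ∀ k, N ≤ φ k := fun k => (Nat.le_add_left N k).trans (hφ₀.id_le _)
  let x : ∀ k, (A (φ k)).domain := fun k => x₀ (k + N)
  have hx : ∀ k, ‖(x k : Hn (φ k))‖ = 1 := fun k => hx₀ _
  have hxw : WeakTendsto (fun k => ((x k : Hn (φ k)) : H₀)) 0 :=
    (weakTendsto_zero_iff.2 hx₀w).comp (tendsto_add_atTop_nat N)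
  have hxδ : Tendsto (fun k => ‖A (φ k) (x k) - z • (x k : Hn (φ k))‖) atTop (𝓝 δ) :=
    hx₀δ.comp (tendsto_add_atTop_nat N)
  choose p q β t ht hr hq hqβ hpr hr1 hr2 hβ1 hβ2 using fun k =>
    (h.pair (φ k)).exists_common_ratio hmpos (hN _ (hφN k)).1 (hN _ (hφN k)).2 (x k) (hx k)
  let r : ∀ k, Hn (φ k) := fun k => A (φ k) (p k) - z • (p k : Hn (φ k))
  let s : ∀ k, Hn (φ k) := fun k => A (φ k) (x k) - z • (x k : Hn (φ k))
  obtain ⟨M, hM⟩ := hxδ.bddAbove_range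
  have hM' : ∀ k, ‖s k‖ ≤ M := fun k => hM ⟨k, rfl⟩
  have hβ0 : ∀ k, 0 ≤ β k := fun k => hqβ k ▸ norm_nonneg _
  have hpb : ∀ k, ‖(p k : Hn (φ k))‖ ≤ 1 / m := fun k => by
    rw [hpr]
    exact (mul_le_of_le_one_right (hβ0 k) (hr2 k)).trans (hβ2 k)
  obtain ⟨⟨β', t', ρ⟩, ⟨hβ'm, ht'm, hρm⟩, ψ₁, hψ₁, hlim⟩ :=
    ((isCompact_Icc (a := (0 : ℝ)) (b := 1 / m)).prod
      ((isCompact_Icc (a := (0 : ℝ)) (b := 1)).prod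
        (isCompact_Icc (a := (0 : ℝ)) (b := 1)))).tendsto_subseq
      (x := fun k => (β k, t k, ‖r k‖))
      fun k => ⟨⟨hβ0 k, hβ2 k⟩, ht k, ⟨norm_nonneg _, hr2 k⟩⟩
  obtain ⟨S, ψ₂, hψ₂, hS⟩ := exists_subseq_weakTendsto (x := fun k => (s (ψ₁ k) : H₀))
    (C := M) (fun k => hM' _)
  obtain ⟨Q, ψ₃, hψ₃, hQ⟩ := exists_subseq_weakTendsto
    (x := fun k => ((q (ψ₁ (ψ₂ k)) : Hn (φ (ψ₁ (ψ₂ k)))) : H₀)) (C := 1 / m)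
    (fun k => (hqβ _).trans_le (hβ2 _))
  obtain ⟨P, ψ₄, hψ₄, hP⟩ := exists_subseq_weakTendsto
    (x := fun k => ((p (ψ₁ (ψ₂ (ψ₃ k))) : Hn (φ (ψ₁ (ψ₂ (ψ₃ k))))) : H₀)) (C := 1 / m)
    (fun k => hpb _)
  let χ : ℕ → ℕ := fun k => ψ₁ (ψ₂ (ψ₃ (ψ₄ k)))
  have hχ : StrictMono χ := hψ₁.comp (hψ₂.comp (hψ₃.comp hψ₄))
  have hφχ : StrictMono fun k => φ (χ k) := hφ.comp hχ
  have hlim' := hlim.comp (hψ₂.comp (hψ₃.comp hψ₄)).tendsto_atTop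
  have hβlim : Tendsto (fun k => β (χ k)) atTop (𝓝 β') :=
    (continuous_fst.tendsto _).comp hlim'
  have htlim : Tendsto (fun k => t (χ k)) atTop (𝓝 t') :=
    ((continuous_fst.comp continuous_snd).tendsto _).comp hlim'
  have hρlim : Tendsto (fun k => ‖r (χ k)‖) atTop (𝓝 ρ) :=
    ((continuous_snd.comp continuous_snd).tendsto _).comp hlim'
  have hδlim : Tendsto (fun k => ‖s (χ k)‖) atTop (𝓝 δ) := hxδ.comp hχ.tendsto_atTop
  have hxw' := hxw.comp hχ.tendsto_atTop
  have hS' : WeakTendsto (fun k => (s (χ k) : H₀)) S := hS.comp (hψ₃.comp hψ₄).tendsto_atTop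
  have hQ' : WeakTendsto (fun k => ((q (χ k) : Hn (φ (χ k))) : H₀)) Q :=
    hQ.comp hψ₄.tendsto_atTop
  -- The pair `(0, S)` lies in the graph of `a - z`. Weak nullness then propagates from `x` and `s`
  -- to `q`, to the combination `r`, and finally to `p`.
  have hS0 : S = 0 := by
    obtain ⟨d, hd, hd'⟩ := h.exists_sub_smul_of_weakTendsto (φ := fun k => φ (χ k))
      hφχ.tendsto_atTop (x := fun k => x (χ k)) (C := 1) (fun k => (hx _).le) (fun k => hM' _)
      hxw' hS'
    have hd0 : d = 0 := Subtype.ext (Subtype.ext hd)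
    rw [← hd', hd0]
    simp
  have hqx : ∀ k, B (φ k) (q k) - starRingEnd ℂ z • (q k : Hn (φ k)) = (x k : Hn (φ k)) := hq
  have hq0 : WeakTendsto (fun k => ((q (χ k) : Hn (φ (χ k))) : H₀)) 0 := by
    refine h.symm.weakTendsto_zero_of_boundedBelow (φ := fun k => φ (χ k)) hφχ.tendsto_atTop
      (x := fun k => q (χ k)) (z := starRingEnd ℂ z) (C := 1 / m) (D := 1) hc hb
      (fun k => (hqβ _).trans_le (hβ2 _)) (fun k => ?_) hQ' ?_
    · rw [hqx]; exact (hx _).le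
    · simp only [hqx]; exact hxw'
  have hδpos : 0 < δ := hδ.1
  have hβδ : 1 ≤ β' * δ := ge_of_tendsto' (hβlim.mul hδlim) fun k => hβ1 _
  have hβ'pos : 0 < β' := by
    by_contra hh
    push Not at hh
    nlinarith
  have hr0 : WeakTendsto (fun k => (r (χ k) : H₀)) 0 := by
    have h1 : Tendsto (fun k => ((((1 - t (χ k)) * ‖s (χ k)‖⁻¹ : ℝ)) : ℂ)) atTop
        (𝓝 (((1 - t') * δ⁻¹ : ℝ) : ℂ)) :=
      (Complex.continuous_ofReal.tendsto _).comp
        ((htlim.const_sub 1).mul (hδlim.inv₀ hδpos.ne'))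
    have h2 : Tendsto (fun k => (((t (χ k) * (β (χ k))⁻¹ : ℝ)) : ℂ)) atTop
        (𝓝 ((t' * β'⁻¹ : ℝ) : ℂ)) :=
      (Complex.continuous_ofReal.tendsto _).comp (htlim.mul (hβlim.inv₀ hβ'pos.ne'))
    rw [hS0] at hS'
    have h3 := (WeakTendsto.smul h1 hS').add (WeakTendsto.smul h2 hq0)
    rw [smul_zero, smul_zero, add_zero] at h3
    have h4 : ∀ k, (r k : H₀) = ((((1 - t k) * ‖s k‖⁻¹ : ℝ)) : ℂ) • (s k : H₀) +
        (((t k * (β k)⁻¹ : ℝ)) : ℂ) • ((q k : Hn (φ k)) : H₀) := fun k =>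
      congrArg Subtype.val (hr k)
    simp only [h4]
    exact h3
  have hp0 : WeakTendsto (fun k => ((p (χ k) : Hn (φ (χ k))) : H₀)) 0 :=
    h.weakTendsto_zero_of_boundedBelow (φ := fun k => φ (χ k)) hφχ.tendsto_atTop
      (x := fun k => p (χ k)) (z := z) hc ha (fun k => hpb _) (fun k => hr2 _) hP hr0
  have hρ : 0 < ρ := by
    have h1 : 1 / 2 ≤ ρ ^ 2 := ge_of_tendsto' (hρlim.pow 2) fun k => hr1 _
    refine lt_of_le_of_ne hρm.1 fun h0 => ?_
    rw [← h0] at h1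
    norm_num at h1
  -- The common level satisfies `1 / β' ≤ δ ≤ ε` because `1 ≤ β' δ`.
  refine ⟨1 / β', ⟨by positivity, ?_⟩, ?_, ?_⟩
  · rw [div_le_iff₀ hβ'pos]
    nlinarith [hδ.2]
  · have h1 := mem_limitingEssNearSpectrum_of_tendsto hφχ (x := fun k => p (χ k)) hp0
      (z := z) (α := β' * ρ) (β := ρ) (by positivity)
      ((hβlim.mul hρlim).congr fun k => (hpr _).symm) hρlim
    have h2 : ρ / (β' * ρ) = 1 / β' := by field_simp
    rwa [h2] at h1
  · refine mem_limitingEssNearSpectrum_of_tendsto hφχ (x := fun k => q (χ k)) hq0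
      (z := starRingEnd ℂ z) (α := β') (β := 1) hβ'pos
      (hβlim.congr fun k => (hqβ _).symm) (tendsto_const_nhds.congr fun k => ?_)
    rw [hqx]
    exact (hx _).symm

/-- Otherwise the `B n - conj z` are eventually uniformly bounded below; compactness of the
resolvents passes this bound to `A n - z`, against the singular sequence. -/
theorem PairConverges.conj_mem_limitingEssSpectrum (h : PairConverges A B a b) {z : ℂ} {c : ℝ}
    (hc : 0 < c) (hb : b.BoundedBelow (starRingEnd ℂ z) c)
    (hcomp : ∀ n, (A n).HasCompactResolvent) (hz : z ∈ limitingEssSpectrum A) :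
    starRingEnd ℂ z ∈ limitingEssSpectrum B := by
  by_contra hzB
  obtain ⟨m, hm, hev⟩ := h.symm.exists_eventually_boundedBelow hc hb hzB
  obtain ⟨φ, hφ, x, hx, -, hlim⟩ := hz
  have hle : ∀ᶠ k in atTop, m ≤ ‖A (φ k) (x k) - z • (x k : Hn (φ k))‖ := by
    filter_upwards [hφ.tendsto_atTop.eventually hev] with k hk
    have h1 := (h.pair (φ k)).symm.boundedBelow_of_hasCompactResolvent
      ((h.pair (φ k)).hasCompactResolvent (hcomp _)) hm hk (x k)
    rw [Complex.conj_conj] at h1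
    have h2 : ‖(x k : Hn (φ k))‖ = 1 := hx k
    rwa [h2, mul_one] at h1
  exact absurd (ge_of_tendsto hlim hle) (not_le.2 hm)

theorem PairConverges.exists_near_of_mem_pollution [CompleteSpace H] (h : PairConverges A B a b)
    {z : ℂ} {ε : ℝ} (hε : 0 < ε) (hz : z ∈ pseudospectralPollution A a ε) :
    (∃ δ ∈ Set.Icc 0 ε, z ∈ limitingEssNearSpectrum A δ) ∨
      ∃ δ ∈ Set.Icc 0 ε, starRingEnd ℂ z ∈ limitingEssNearSpectrum B δ := by
  obtain ⟨hz, φ, hφ, μ, hμ, hμz⟩ := hz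
  have hex : ∀ k : ℕ, ∃ w ∈ (A (φ k)).pseudospectrum ε, dist (μ k) w < 1 / ((k : ℝ) + 1) :=
    fun k => Metric.mem_closure_iff.1 (hμ k) _ (by positivity)
  choose ν hν hνμ using hex
  have hνz : Tendsto ν atTop (𝓝 z) :=
    hμz.congr_dist (squeeze_zero (fun _ => dist_nonneg) (fun k => (hνμ k).le)
      tendsto_one_div_add_atTop_nhds_zero_nat)
  -- At each `ν k` one of the two lower bounds fails; if failures for `A` are not frequent, those
  -- for `B` are eventual.
  by_cases hA : ∃ᶠ k in atTop, ¬ (A (φ k)).BoundedBelow (ν k) ε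
  · exact Or.inl (h.exists_near_of_frequently hε hz hφ hνz hA)
  · refine Or.inr (h.symm.exists_near_of_frequently hε
      (h.pair_lim.conj_notMem_closure_pseudospectrum hε hz) hφ
      ((Complex.continuous_conj.tendsto z).comp hνz) ?_)
    rw [not_frequently] at hA
    refine (hA.mono fun k hk hB => ?_).frequently
    exact ((h.pair (φ k)).notMem_pseudospectrum_iff hε).2 ⟨not_not.1 hk, hB⟩ (hν k)

theorem mem_conjSet {Ω : Set ℂ} {z : ℂ} : z ∈ conjSet Ω ↔ starRingEnd ℂ z ∈ Ω := by
  constructor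
  · rintro ⟨w, hw, rfl⟩
    rwa [Complex.conj_conj]
  · exact fun h => ⟨_, h, Complex.conj_conj z⟩

theorem PairConverges.mem_of_mem_pollution [CompleteSpace H] (h : PairConverges A B a b) {z : ℂ}
    {ε : ℝ} (hε : 0 < ε) (hz : z ∈ pseudospectralPollution A a ε) :
    z ∈ limitingEssSpectrum A ∨ starRingEnd ℂ z ∈ limitingEssSpectrum B ∨
      ∃ δ ∈ Set.Ioc 0 ε, z ∈ limitingEssNearSpectrum A δ ∧
        starRingEnd ℂ z ∈ limitingEssNearSpectrum B δ := by
  by_cases hA : z ∈ limitingEssSpectrum A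
  · exact Or.inl hA
  by_cases hB : starRingEnd ℂ z ∈ limitingEssSpectrum B
  · exact Or.inr (Or.inl hB)
  refine Or.inr (Or.inr ?_)
  obtain ⟨ha, hb⟩ := (h.pair_lim.notMem_pseudospectrum_iff hε).1
    fun h' => hz.1 (subset_closure h')
  rcases h.exists_near_of_mem_pollution hε hz with ⟨δ, hδ, hmem⟩ | ⟨δ, hδ, hmem⟩
  · have hδ0 : 0 < δ := lt_of_le_of_ne hδ.1 fun h0 => hA (by rw [← h0] at hmem; exact hmem)
    exact h.exists_common_mem_limitingEssNearSpectrum hε ha hb hA hB ⟨hδ0, hδ.2⟩ hmem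
  · have hδ0 : 0 < δ := lt_of_le_of_ne hδ.1 fun h0 => hB (by rw [← h0] at hmem; exact hmem)
    obtain ⟨δ', hδ', h1, h2⟩ := h.symm.exists_common_mem_limitingEssNearSpectrum hε hb
      (by rwa [Complex.conj_conj]) hB (by rwa [Complex.conj_conj]) ⟨hδ0, hδ.2⟩ hmem
    exact ⟨δ', hδ', by rwa [Complex.conj_conj] at h2, h1⟩

end Pollution

-- Pseudospectral inclusion and Hausdorff convergence.

section Inclusion

variable {H₀ : Type*} [NormedAddCommGroup H₀] [InnerProductSpace ℂ H₀]
  {H : Submodule ℂ H₀} {Hn : ℕ → Submodule ℂ H₀}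
  {A B : ∀ n, Hn n →ₗ.[ℂ] Hn n} {a b : H →ₗ.[ℂ] H}

theorem GraphConverges.eventually_not_boundedBelow (h : GraphConverges A a) {z : ℂ} {c : ℝ}
    (hz : ¬ a.BoundedBelow z c) : ∀ᶠ n in atTop, ¬ (A n).BoundedBelow z c := by
  simp only [LinearPMap.BoundedBelow, not_forall, not_le] at hz
  obtain ⟨x, hx⟩ := hz
  obtain ⟨u, hu, hAu⟩ := h x
  filter_upwards [(hAu.sub (hu.const_smul z)).norm.eventually_lt (hu.norm.const_mul c) hx]
    with n hn hb
  exact absurd (hb (u n)) (not_le.2 hn)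

variable [H.HasOrthogonalProjection] [∀ n, (Hn n).HasOrthogonalProjection]
  [∀ n, CompleteSpace (Hn n)] [CompleteSpace H]

theorem PairConverges.eventually_mem_pseudospectrum (h : PairConverges A B a b) {z : ℂ} {ε : ℝ}
    (hε : 0 < ε) (hz : z ∈ a.pseudospectrum ε) : ∀ᶠ n in atTop, z ∈ (A n).pseudospectrum ε := by
  have h1 : ¬ (a.BoundedBelow z ε ∧ b.BoundedBelow (starRingEnd ℂ z) ε) := fun h' =>
    (h.pair_lim.notMem_pseudospectrum_iff hε).2 h' hz
  rw [not_and_or] at h1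
  have h2 : ∀ᶠ n in atTop,
      ¬ ((A n).BoundedBelow z ε ∧ (B n).BoundedBelow (starRingEnd ℂ z) ε) := by
    rcases h1 with h1 | h1
    · exact (h.graph_left.eventually_not_boundedBelow h1).mono fun n hn h' => hn h'.1
    · exact (h.graph_right.eventually_not_boundedBelow h1).mono fun n hn h' => hn h'.2
  filter_upwards [h2] with n hn
  by_contra hzn
  exact hn (((h.pair n).notMem_pseudospectrum_iff hε).1 hzn)

theorem PairConverges.pseudospectrallyInclusive (h : PairConverges A B a b) {ε : ℝ} (hε : 0 < ε) :
    PseudospectrallyInclusive A a ε := by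
  intro z hz
  -- `μ n` is a nearest point to `z`; the default `0` serves only for an empty pseudospectrum.
  have hex : ∀ n, ∃ w : ℂ, (closure ((A n).pseudospectrum ε)).Nonempty →
      w ∈ closure ((A n).pseudospectrum ε) ∧
        Metric.infDist z (closure ((A n).pseudospectrum ε)) = dist z w := fun n => by
    by_cases hne : (closure ((A n).pseudospectrum ε)).Nonempty
    · obtain ⟨w, hw, hw'⟩ := isClosed_closure.exists_infDist_eq_dist hne z
      exact ⟨w, fun _ => ⟨hw, hw'⟩⟩
    · exact ⟨0, fun h' => absurd h' hne⟩
  choose μ hμ using hex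
  have hnear : ∀ e > 0, ∀ᶠ n in atTop, μ n ∈ closure ((A n).pseudospectrum ε) ∧
      dist (μ n) z < e := fun e he => by
    obtain ⟨w, hw, hwz⟩ := Metric.mem_closure_iff.1 hz e he
    filter_upwards [h.eventually_mem_pseudospectrum hε hw] with n hn
    obtain ⟨h1, h2⟩ := hμ n ⟨w, subset_closure hn⟩
    refine ⟨h1, ?_⟩
    rw [dist_comm, ← h2]
    exact (Metric.infDist_le_dist_of_mem (subset_closure hn)).trans_lt hwz
  refine ⟨μ, fun n hn => ?_, (hnear 1 one_pos).mono fun n hn => hn.1,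
    Metric.tendsto_nhds.2 fun e he => (hnear e he).mono fun n hn => hn.2⟩
  have : Nontrivial (Hn n) := Submodule.nontrivial_iff_ne_bot.2 hn
  exact (hμ n ((LinearPMap.pseudospectrum_nonempty (A n) ε).mono subset_closure)).1

theorem PairConverges.tendsto_hausdorffEDist (h : PairConverges A B a b) {ε : ℝ} (hε : 0 < ε)
    {K : Set ℂ} (hK : IsCompact K)
    (hKcl : closure (a.pseudospectrum ε) ∩ K = closure (a.pseudospectrum ε ∩ K))
    (hpol : ∀ z ∈ K, z ∉ pseudospectralPollution A a ε) :
    Tendsto (fun n => Metric.hausdorffEDist (closure ((A n).pseudospectrum ε) ∩ K)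
        (closure (a.pseudospectrum ε) ∩ K)) atTop (𝓝 0) := by
  have hlower : ∀ e > 0, ∀ᶠ n in atTop, ∀ z ∈ closure (a.pseudospectrum ε) ∩ K,
      ∃ w ∈ closure ((A n).pseudospectrum ε) ∩ K, dist z w < e := fun e he => by
    -- The net is taken inside `a.pseudospectrum ε ∩ K`, so its points lie in `K` and eventually in
    -- every pseudospectrum of `A n`; `hKcl` makes it a net for the closed set too.
    obtain ⟨t, ht, htf, hcov⟩ := Metric.finite_approx_of_totallyBounded
      (hK.totallyBounded.subset (Set.inter_subset_right (s := a.pseudospectrum ε))) (e / 2)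
      (by positivity)
    have hev : ∀ᶠ n in atTop, ∀ w ∈ t, w ∈ (A n).pseudospectrum ε :=
      (eventually_all_finite htf).2 fun w hw => h.eventually_mem_pseudospectrum hε (ht hw).1
    filter_upwards [hev] with n hn z hz
    rw [hKcl] at hz
    obtain ⟨y, hy, hzy⟩ := Metric.mem_closure_iff.1 hz (e / 2) (by positivity)
    obtain ⟨w, hw, hyw⟩ := Set.mem_iUnion₂.1 (hcov hy)
    refine ⟨w, ⟨subset_closure (hn w hw), (ht hw).2⟩, ?_⟩
    rw [Metric.mem_ball] at hyw
    linarith [dist_triangle z y w]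
  have hupper : ∀ e > 0, ∀ᶠ n in atTop, ∀ z ∈ closure ((A n).pseudospectrum ε) ∩ K,
      ∃ w ∈ closure (a.pseudospectrum ε) ∩ K, dist z w < e := fun e he => by
    -- Points of `K` staying `e` away from the limit set would accumulate in `K` at a point of
    -- pollution.
    by_contra hcon
    obtain ⟨φ, hφ, hφ'⟩ := extraction_of_frequently_atTop (not_eventually.1 hcon)
    push Not at hφ'
    choose μ hμ hμfar using hφ'
    obtain ⟨z, hzK, ψ, hψ, hlim⟩ := hK.tendsto_subseq fun k => (hμ k).2
    by_cases hz : z ∈ closure (a.pseudospectrum ε)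
    · obtain ⟨k, hk⟩ := ((Metric.tendsto_nhds.1 hlim) e he).exists
      exact absurd hk (not_lt.2 (hμfar _ z ⟨hz, hzK⟩))
    · exact hpol z hzK ⟨hz, fun k => φ (ψ k), hφ.comp hψ, fun k => μ (ψ k), fun k => (hμ _).1, hlim⟩
  rw [ENNReal.tendsto_nhds_zero]
  intro r hr
  obtain ⟨e, he, her⟩ := ENNReal.lt_iff_exists_nnreal_btwn.1 hr
  have he' : (0 : ℝ) < e := by exact_mod_cast he
  have hle : ∀ z w : ℂ, dist z w < e → edist z w ≤ r := fun z w hzw => by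
    refine le_trans ?_ her.le
    rw [edist_nndist]
    exact_mod_cast hzw.le
  filter_upwards [hlower e he', hupper e he'] with n h1 h2
  refine Metric.hausdorffEDist_le_of_mem_edist (fun z hz => ?_) fun z hz => ?_
  · obtain ⟨w, hw, hzw⟩ := h2 z hz
    exact ⟨w, hw, hle z w hzw⟩
  · obtain ⟨w, hw, hzw⟩ := h1 z hz
    exact ⟨w, hw, hle z w hzw⟩

end Inclusion

-- The main theorem.

theorem mainTheorem2 {H₀ : Type*} [NormedAddCommGroup H₀] [InnerProductSpace ℂ H₀]
    [CompleteSpace H₀] [TopologicalSpace.SeparableSpace H₀] (_hinf : ¬ FiniteDimensional ℂ H₀)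
    (H : Submodule ℂ H₀) (Hn : ℕ → Submodule ℂ H₀)
    [CompleteSpace H] [∀ n, CompleteSpace (Hn n)]
    (hP : ∀ x : H₀, Tendsto (fun n => (((Hn n).orthogonalProjectionOnto x : Hn n) : H₀)) atTop
      (𝓝 ((H.orthogonalProjectionOnto x : H) : H₀)))
    (T : H →ₗ.[ℂ] H) (Tn : ∀ n, Hn n →ₗ.[ℂ] Hn n)
    (hTclosed : T.IsClosed) (hTdense : Dense (T.domain : Set H))
    (hTnclosed : ∀ n, (Tn n).IsClosed) (hTndense : ∀ n, Dense ((Tn n).domain : Set (Hn n)))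
    (hgsr : GSRConverges Tn T) (hgsr_adj : GSRConverges (fun n => (Tn n).adjoint) T.adjoint)
    (ε : ℝ) (hε : 0 < ε) :
    PseudospectrallyInclusive Tn T ε ∧
    pseudospectralPollution Tn T ε ⊆ exceptionalSet Tn ε ∧
    ((∀ n, (Tn n).HasCompactResolvent) →
      pseudospectralPollution Tn T ε ⊆ exceptionalSetCompact Tn ε) ∧
    ∀ K : Set ℂ, IsCompact K →
      closure (T.pseudospectrum ε) ∩ K = closure (T.pseudospectrum ε ∩ K) →
      (closure (T.pseudospectrum ε) ∩ K).Nonempty →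
      (K ∩ exceptionalSet Tn ε ⊆ closure (T.pseudospectrum ε) ∨
        ((∀ n, (Tn n).HasCompactResolvent) ∧
          K ∩ exceptionalSetCompact Tn ε ⊆ closure (T.pseudospectrum ε))) →
      Tendsto (fun n => Metric.hausdorffEDist (closure ((Tn n).pseudospectrum ε) ∩ K)
        (closure (T.pseudospectrum ε) ∩ K)) atTop (𝓝 0) := by
  have h : PairConverges Tn (fun n => (Tn n).adjoint) T T.adjoint :=
    ⟨hP, fun n => LinearPMap.isAdjointPair_adjoint (hTnclosed n) (hTndense n),
      LinearPMap.isAdjointPair_adjoint hTclosed hTdense, hgsr.graphConverges hP,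
      hgsr_adj.graphConverges hP⟩
  have hpol : pseudospectralPollution Tn T ε ⊆ exceptionalSet Tn ε := fun z hz => by
    rcases h.mem_of_mem_pollution hε hz with h1 | h1 | ⟨δ, hδ, h1, h2⟩
    · exact Or.inl (Or.inl h1)
    · exact Or.inl (Or.inr (mem_conjSet.2 h1))
    · exact Or.inr (Set.mem_iUnion₂.2 ⟨δ, hδ, h1, mem_conjSet.2 h2⟩)
  have hpolc : (∀ n, (Tn n).HasCompactResolvent) →
      pseudospectralPollution Tn T ε ⊆ exceptionalSetCompact Tn ε := fun hcomp z hz => by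
    obtain ⟨ha, hb⟩ := (h.pair_lim.notMem_pseudospectrum_iff hε).1
      fun h' => hz.1 (subset_closure h')
    rcases h.mem_of_mem_pollution hε hz with h1 | h1 | ⟨δ, hδ, h1, h2⟩
    · exact Or.inl ⟨h1, mem_conjSet.2 (h.conj_mem_limitingEssSpectrum hε hb hcomp h1)⟩
    · have h2 := h.symm.conj_mem_limitingEssSpectrum hε (by rwa [Complex.conj_conj])
        (fun n => (h.pair n).hasCompactResolvent (hcomp n)) h1
      rw [Complex.conj_conj] at h2
      exact Or.inl ⟨h2, mem_conjSet.2 h1⟩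
    · exact Or.inr (Set.mem_iUnion₂.2 ⟨δ, hδ, h1, mem_conjSet.2 h2⟩)
  refine ⟨h.pseudospectrallyInclusive hε, hpol, hpolc, fun K hK hKcl _ hex => ?_⟩
  refine h.tendsto_hausdorffEDist hε hK hKcl fun z hzK hz => ?_
  rcases hex with hex | ⟨hcomp, hex⟩
  · exact hz.1 (hex ⟨hzK, hpol hz⟩)
  · exact hz.1 (hex ⟨hzK, hpolc hcomp hz⟩)
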